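/- Let $\mathcal P$ be a nonzero commutative ring with identity, let $n=2m\ge 6$, and let $C_n$ be the cycle with vertices $v_1,\dots,v_n$, where indices are read modulo $n$ (so $v_0=v_n$ and $x_0=x_n$). Let $L(C_n,X)$ be its generalized Laplacian matrix over $\mathcal P[x_1,\dots,x_n]$: the entry $(u,v)$ is $x_u$ if $u=v$, $-1$ if $u$ and $v$ are adjacent, and $0$ otherwise. Let $I_{n-1}(C_n,X)\subseteq\mathcal P[x_1,\dots,x_n]$ be the ideal generated by all $(n-1)$-minors of $L(C_n,X)$, that is, the $(n-1)$-th critical ideal of $C_n$. Fix the graded lexicographic order with $$x_{m-1}>x_m>\cdots>x_{2m}>x_1>\cdots>x_{m-2}.$$ For vertices $i,j$ let $Q_{i,j}$ be the matrix obtained from $L(C_n,X)$ by deleting row $i$ and column $j$, and let $q_{i,j}=-\det Q_{i,j}$ if the leading coefficient of $\det Q_{i,j}$ is $-1$, and $q_{i,j}=\det Q_{i,j}$ otherwise. Put $$B_0=\{q_{i,i+m} : 0\le i\le m-1\}\cup\{q_{i+m,i+1} : 0\le i\le m-2\}.$$ Then $B_0$ is a Gröbner basis of $I_{n-1}(C_n,X)$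 with respect to this order: $B_0$ is a finite set of nonzero elements of $I_{n-1}(C_n,X)$, and the ideal generated by the leading terms of the elements of $B_0$ equals the ideal generated by the leading terms of the elements of $I_{n-1}(C_n,X)$. -/

import Mathlib

/-- The generalized Laplacian matrix `L(G, X)` of a simple graph over the base ring `R`: the variable
`x_u` at the diagonal entry `u`, and minus the number of arcs from `u` to `v` off the diagonal. -/
noncomputable def genLaplacian (R : Type*) [CommRing R] {V : Type*} [DecidableEq V]
    (G : SimpleGraph V) [DecidableRel G.Adj] : Matrix V V (MvPolynomial V R) :=
  Matrix.of fun u v => if u = v then MvPolynomial.X u else if G.Adj u v then -1 else 0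

/-- The ideal generated by all `k`-minors of an `n × n` matrix. A `k`-square submatrix is given by its
rows and columns, enumerated increasingly. -/
def minorsIdeal {A : Type*} [CommRing A] {n : ℕ} (k : ℕ) (M : Matrix (Fin n) (Fin n) A) : Ideal A :=
  Ideal.span {f | ∃ rows cols : Fin k ↪o Fin n, f = (M.submatrix rows cols).det}

/-- The `k`-th critical ideal `I_k(G, X)` of a graph with `n` vertices. -/
noncomputable def criticalIdeal (R : Type*) [CommRing R] {n : ℕ} (k : ℕ)
    (G : SimpleGraph (Fin n)) [DecidableRel G.Adj] : Ideal (MvPolynomial (Fin n) R) :=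
  minorsIdeal k (genLaplacian R G)

/-- The increasing enumeration of the indices of `Fin n` other than `i`. -/
def omitIdx {n : ℕ} (i : Fin n) (a : Fin (n - 1)) : Fin n :=
  if (a : ℕ) < i then ⟨a, by omega⟩ else ⟨a + 1, by omega⟩

/-- The matrix `M(i; j)`: delete row `i` and column `j`. -/
def deleteRowCol {A : Type*} {n : ℕ} (M : Matrix (Fin n) (Fin n) A) (i j : Fin n) :
    Matrix (Fin (n - 1)) (Fin (n - 1)) A :=
  M.submatrix (omitIdx i) (omitIdx j)

open Classical in
/-- The polynomial `q_{i,j}` of the cycle `C_n`: the determinant of `L(C_n, X)(i; j)`, with its sign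
changed if its leading coefficient is `-1`. The vertex `v_k` of `C_n` is the residue class of `k`
modulo `n`, so that `v_n` is `0 : Fin n`. -/
noncomputable def cycleQ (R : Type*) [CommRing R] {n : ℕ} (ord : MonomialOrder (Fin n))
    (i j : Fin n) : MvPolynomial (Fin n) R :=
  let d := (deleteRowCol (genLaplacian R (SimpleGraph.cycleGraph n)) i j).det
  if ord.leadingCoeff d = -1 then -d else d

/-- `B` is a Gröbner basis of the ideal `I` with respect to `ord`: a finite set of nonzero elements
of `I` such that the leading terms of `B` and those of `I` generate the same ideal. -/
def IsGroebnerBasis {σ R : Type*} [CommRing R] (ord : MonomialOrder σ)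
    (B : Set (MvPolynomial σ R)) (I : Ideal (MvPolynomial σ R)) : Prop :=
  B.Finite ∧ (∀ b ∈ B, b ≠ 0) ∧ B ⊆ (I : Set (MvPolynomial σ R)) ∧
    Ideal.span (ord.leadingTerm '' B) =
      Ideal.span (ord.leadingTerm '' (I : Set (MvPolynomial σ R)))

/-- The position of the variable `x_j` (with `x_{2m}` written `j = 0`) in the list
`x_{m-1}, x_m, …, x_{2m}, x_1, …, x_{m-2}`, counted from `0`. -/
def evenCycleRank (m : ℕ) (j : Fin (2 * m)) : ℕ :=
  if m ≤ (j : ℕ) + 1 then (j : ℕ) + 1 - m else (j : ℕ) + m + 1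

theorem evenCycleRank_injective (m : ℕ) : Function.Injective (evenCycleRank m) := by
  intro a b h
  unfold evenCycleRank at h
  ext
  split_ifs at h <;> omega

/-- The indices of the variables, listed by `evenCycleRank`. -/
abbrev evenCycleIndexOrder (m : ℕ) : LinearOrder (Fin (2 * m)) :=
  LinearOrder.lift' (evenCycleRank m) (evenCycleRank_injective m)

/-- The graded lexicographic order with `x_{m-1} > x_m > ⋯ > x_{2m} > x_1 > ⋯ > x_{m-2}`. In
`MonomialOrder.degLex` the least index carries the greatest variable. -/
noncomputable def evenCycleDegLex (m : ℕ) : MonomialOrder (Fin (2 * m)) :=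
  @MonomialOrder.degLex (Fin (2 * m)) (evenCycleIndexOrder m)
    (@Finite.to_wellFoundedGT (Fin (2 * m)) inferInstance (evenCycleIndexOrder m).toPreorder)

/-- The set `B₀ = {q_{i,i+m} : 0 ≤ i ≤ m-1} ∪ {q_{i+m,i+1} : 0 ≤ i ≤ m-2}`. -/
noncomputable def evenCycleBasis (R : Type*) [CommRing R] (m : ℕ) :
    Set (MvPolynomial (Fin (2 * m)) R) :=
  {f | ∃ (i : ℕ) (_ : i < m),
      f = cycleQ R (evenCycleDegLex m) ⟨i, by omega⟩ ⟨i + m, by omega⟩} ∪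
  {f | ∃ (i : ℕ) (_ : i + 1 < m),
      f = cycleQ R (evenCycleDegLex m) ⟨i + m, by omega⟩ ⟨i + 1, by omega⟩}

/-! Write n = 2m and let a(i,j) be the entries of adj L, indices mod n. They form a symmetric
matrix, and up to sign they are the (n-1)-minors, so they generate the critical ideal. Off the
diagonal, L · adj L = det L · 1 reads x_{i+1} a(i+1,j) = a(i,j) + a(i+2,j). Every reduction below
comes from this three-term relation. Put O_p = a(p+m,p) (opposite vertices) and N_p = a(p+m+1,p). Up
to sign, B₀ consists of O_p for 0 ≤ p < m and N_p for m ≤ p ≤ 2m-2; call its p-th element b_p.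

Generation: x_{p+m} O_p = N_{p+m-1} + N_p produces the N_p missing from B₀, and the relation then
lowers the distance between i and j step by step.

Leading terms: off the diagonal, a(i,j) has the leading term of the sum of the continuants of the
two arcs between i and j (`det_mul_arcSum`, `degree_cycleAdj`). For N_p the longer arc wins by
degree. For O_p both arcs have m-1 interior vertices, and x_{m-1}, or x_m when p = m-1, breaks the
tie. So the leading monomial of b_p is the product of the m-1 or m consecutive variables after x_p.
Beyond total degree, only the two greatest variables of the order are ever compared.

Buchberger: all b_p are monic, so the criterion works over any nonzero ring. "The multiples of b_i
and b_j with leading exponent u agree modulo smaller multiples" is an equivalence relation on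
indices. Coprime pairs satisfy it automatically. If two windows overlap, the windows starting
between them, on the appropriate side of the cycle, divide any common multiple. Hence only
cyclically consecutive pairs need an explicit S-polynomial (`congrBelow_short`, `congrBelow_middle`,
`congrBelow_long`, `congrBelow_last`). -/

/-! ### Buchberger's criterion for monic families over a commutative ring. -/

namespace MonomialOrder

open MvPolynomial

variable {σ R ι : Type*} [CommRing R] (ord : MonomialOrder σ) (b : ι → MvPolynomial σ R)

/-- The linear combinations of the monomial multiples of the `b k` whose leading exponent is smaller
than `u`. -/
noncomputable def below (u : σ →₀ ℕ) : Submodule R (MvPolynomial σ R) :=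
  Submodule.span R {f | ∃ (v : σ →₀ ℕ) (k : ι),
    ord.toSyn (v + ord.degree (b k)) < ord.toSyn u ∧ f = monomial v 1 * b k}

/-- The multiples of `b i` and `b j` with leading exponent `u` agree up to smaller multiples. -/
def CongrBelow (u : σ →₀ ℕ) (i j : ι) : Prop :=
  monomial (u - ord.degree (b i)) 1 * b i - monomial (u - ord.degree (b j)) 1 * b j ∈
    ord.below b u

theorem mul_mem_of_monomial_mul_mem (N : Submodule R (MvPolynomial σ R))
    {f : MvPolynomial σ R} (p : MvPolynomial σ R) (h : ∀ d ∈ p.support, monomial d 1 * f ∈ N) :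
    p * f ∈ N := by
  rw [p.as_sum, Finset.sum_mul]
  refine Submodule.sum_mem _ fun d hd => ?_
  have e : monomial d (coeff d p) = coeff d p • monomial d (1 : R) := by
    rw [smul_monomial, smul_eq_mul, mul_one]
  rw [e, smul_mul_assoc]
  exact Submodule.smul_mem _ _ (h d hd)

variable {ord b}

theorem monomial_mul_mem_below {u v : σ →₀ ℕ} {k : ι}
    (h : ord.toSyn (v + ord.degree (b k)) < ord.toSyn u) :
    monomial v 1 * b k ∈ ord.below b u :=
  Submodule.subset_span ⟨v, k, h, rfl⟩

theorem mem_below {u : σ →₀ ℕ} {k : ι} (h : ord.toSyn (ord.degree (b k)) < ord.toSyn u) :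
    b k ∈ ord.below b u := by
  have := monomial_mul_mem_below (b := b) (v := 0) (k := k) (u := u) (by simpa using h)
  simpa using this

theorem X_mul_mem_below {u : σ →₀ ℕ} {k : ι} {s : σ}
    (h : ord.toSyn (Finsupp.single s 1 + ord.degree (b k)) < ord.toSyn u) :
    X s * b k ∈ ord.below b u :=
  monomial_mul_mem_below h

theorem mul_mem_below {u : σ →₀ ℕ} {k : ι} (p : MvPolynomial σ R)
    (h : ∀ d ∈ p.support, ord.toSyn (d + ord.degree (b k)) < ord.toSyn u) :
    p * b k ∈ ord.below b u := by
  exact mul_mem_of_monomial_mul_mem _ p fun d hd => monomial_mul_mem_below (h d hd)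

theorem monomial_mul_mem_below_add {u : σ →₀ ℕ} (t : σ →₀ ℕ) {f : MvPolynomial σ R}
    (hf : f ∈ ord.below b u) : monomial t 1 * f ∈ ord.below b (t + u) := by
  induction hf using Submodule.span_induction with
  | mem x hx =>
    obtain ⟨v, k, h, rfl⟩ := hx
    rw [← mul_assoc, monomial_mul, mul_one]
    refine monomial_mul_mem_below ?_
    rw [add_assoc, map_add, map_add ord.toSyn t u]
    exact add_lt_add_right h _
  | zero => simp
  | add x y _ _ hx hy => rw [mul_add]; exact Submodule.add_mem _ hx hy
  | smul a x _ hx => rw [mul_smul_comm]; exact Submodule.smul_mem _ _ hx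

theorem CongrBelow.refl (u : σ →₀ ℕ) (i : ι) : ord.CongrBelow b u i i := by
  simp [CongrBelow]

theorem CongrBelow.symm {u : σ →₀ ℕ} {i j : ι} (h : ord.CongrBelow b u i j) :
    ord.CongrBelow b u j i := by
  have := Submodule.neg_mem _ h
  rwa [neg_sub] at this

theorem CongrBelow.trans {u : σ →₀ ℕ} {i j k : ι} (h : ord.CongrBelow b u i j)
    (h' : ord.CongrBelow b u j k) : ord.CongrBelow b u i k := by
  have := Submodule.add_mem _ h h'
  rwa [sub_add_sub_cancel] at this

/-- Reduction to one common multiple u₀, in practice the lcm: multiplying a congruence at u₀ by the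
monomial of exponent u - u₀ gives the one at u. -/
theorem CongrBelow.of_le {u₀ u α β : σ →₀ ℕ} {i j : ι} (hu : u₀ ≤ u)
    (hi : α + ord.degree (b i) = u₀) (hj : β + ord.degree (b j) = u₀)
    (h : monomial α 1 * b i - monomial β 1 * b j ∈ ord.below b u₀) :
    ord.CongrBelow b u i j := by
  have key := monomial_mul_mem_below_add (u - u₀) h
  rw [tsub_add_cancel_of_le hu, mul_sub, ← mul_assoc, ← mul_assoc, monomial_mul, monomial_mul,
    mul_one] at key
  have ei : u - u₀ + α = u - ord.degree (b i) := by
    refine eq_tsub_of_add_eq ?_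
    rw [add_assoc, hi, tsub_add_cancel_of_le hu]
  have ej : u - u₀ + β = u - ord.degree (b j) := by
    refine eq_tsub_of_add_eq ?_
    rw [add_assoc, hj, tsub_add_cancel_of_le hu]
  rwa [ei, ej] at key

theorem toSyn_lt_of_mem_support_sub {f : MvPolynomial σ R} (hf : ord.Monic f) {d : σ →₀ ℕ}
    (hd : d ∈ (f - monomial (ord.degree f) 1).support) :
    ord.toSyn d < ord.toSyn (ord.degree f) := by
  classical
  rw [mem_support_iff, coeff_sub, coeff_monomial] at hd
  have hne : ord.degree f ≠ d := by
    rintro rfl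
    rw [hf.coeff_degree] at hd
    simp at hd
  rw [if_neg hne, sub_zero] at hd
  refine lt_of_le_of_ne (ord.le_degree (mem_support_iff.mpr hd)) fun h => hne ?_
  exact (ord.toSyn.injective h).symm

/-- Buchberger's product criterion: lm(g) f - lm(f) g = (f - lm f) g - (g - lm g) f, and both tails
lie strictly below their leading monomials. -/
theorem CongrBelow.of_coprime {u : σ →₀ ℕ} {i j : ι} (mi : ord.Monic (b i))
    (mj : ord.Monic (b j)) (hc : ∀ s, ord.degree (b i) s = 0 ∨ ord.degree (b j) s = 0)
    (hi : ord.degree (b i) ≤ u) (hj : ord.degree (b j) ≤ u) : ord.CongrBelow b u i j := by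
  refine CongrBelow.of_le (u₀ := ord.degree (b j) + ord.degree (b i)) ?_ rfl (add_comm _ _) ?_
  · intro s
    have := hc s
    have := hi s
    have := hj s
    rw [Finsupp.add_apply]
    omega
  · have e : monomial (ord.degree (b j)) 1 * b i - monomial (ord.degree (b i)) 1 * b j =
        (b i - monomial (ord.degree (b i)) 1) * b j -
          (b j - monomial (ord.degree (b j)) 1) * b i := by ring
    rw [e]
    refine Submodule.sub_mem _ (mul_mem_below _ fun d hd => ?_) (mul_mem_below _ fun d hd => ?_)
    · rw [add_comm (ord.degree (b j)), map_add, map_add]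
      exact add_lt_add_left (toSyn_lt_of_mem_support_sub mi hd) _
    · rw [map_add, map_add]
      exact add_lt_add_left (toSyn_lt_of_mem_support_sub mj hd) _

/-- Distinct leading exponents exclude cancellation at the greatest one, and monicity keeps its
coefficient equal to the scalar even when `R` has zero divisors. -/
theorem exists_degree_eq_of_mem_span {U : Set (σ →₀ ℕ)} {e : U → MvPolynomial σ R}
    (hm : ∀ u, ord.Monic (e u)) (hd : ∀ u, ord.degree (e u) = u) {f : MvPolynomial σ R}
    (hf : f ∈ Submodule.span R (Set.range e)) (h0 : f ≠ 0) : ord.degree f ∈ U := by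
  obtain ⟨c, rfl⟩ := Finsupp.mem_span_range_iff_exists_finsupp.mp hf
  have hc : c.support.Nonempty := by
    rw [Finsupp.support_nonempty_iff]
    rintro rfl
    simp at h0
  obtain ⟨u, hu, hmax⟩ := Finset.exists_max_image c.support (fun u => ord.toSyn (u : σ →₀ ℕ)) hc
  have hcoeff : ∀ d : σ →₀ ℕ, coeff d (c.sum fun i a => a • e i) =
      ∑ i ∈ c.support, c i * coeff d (e i) := by
    intro d
    simp [Finsupp.sum, coeff_sum]
  have h1 : coeff (u : σ →₀ ℕ) (c.sum fun i a => a • e i) = c u := by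
    rw [hcoeff, Finset.sum_eq_single_of_mem u hu]
    · have := (hm u).coeff_degree
      rw [hd] at this
      rw [this, mul_one]
    · intro v hv hvu
      rw [ord.coeff_eq_zero_of_lt, mul_zero]
      rw [hd]
      exact lt_of_le_of_ne (hmax v hv) fun h => hvu (Subtype.ext (ord.toSyn.injective h))
  have hle : ord.toSyn u ≤ ord.toSyn (ord.degree (c.sum fun i a => a • e i)) :=
    ord.le_degree (by rw [mem_support_iff, h1]; exact Finsupp.mem_support_iff.mp hu)
  have hge : ord.toSyn (ord.degree (c.sum fun i a => a • e i)) ≤ ord.toSyn u := by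
    by_contra hlt
    rw [not_le] at hlt
    refine (ord.coeff_degree_ne_zero_iff.mpr h0) ?_
    rw [hcoeff]
    refine Finset.sum_eq_zero fun v hv => ?_
    rw [ord.coeff_eq_zero_of_lt, mul_zero]
    rw [hd]
    exact (hmax v hv).trans_lt hlt
  rw [ord.toSyn.injective (le_antisymm hge hle)]
  exact u.2

/-- Buchberger's criterion for monic families. -/
theorem exists_degree_le_of_mem_span [Nontrivial R] [Fintype ι] (hm : ∀ i, ord.Monic (b i))
    (h : ∀ i j u, ord.degree (b i) ≤ u → ord.degree (b j) ≤ u → ord.CongrBelow b u i j)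
    {f : MvPolynomial σ R} (hf : f ∈ Ideal.span (Set.range b)) (h0 : f ≠ 0) :
    ∃ i, ord.degree (b i) ≤ ord.degree f := by
  let U : Set (σ →₀ ℕ) := {u | ∃ i, ord.degree (b i) ≤ u}
  let k : U → ι := fun u => u.2.choose
  have hk : ∀ u : U, ord.degree (b (k u)) ≤ u := fun u => u.2.choose_spec
  -- One chosen multiple for each exponent that some leading exponent divides. The congruences make
  -- the choice immaterial, so these multiples span the whole ideal over `R`.
  let e : U → MvPolynomial σ R := fun u => monomial ((u : σ →₀ ℕ) - ord.degree (b (k u))) 1 * b (k u)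
  have em : ∀ u, ord.Monic (e u) := fun u => (ord.monic_monomial_one).mul (hm _)
  have ed : ∀ u, ord.degree (e u) = u := by
    classical
    intro u
    rw [degree_mul_of_mul_leadingCoeff_ne_zero, degree_monomial, if_neg one_ne_zero,
      tsub_add_cancel_of_le (hk u)]
    rw [(hm _).leadingCoeff_eq_one, leadingCoeff_monomial, mul_one]
    exact one_ne_zero
  -- Well-founded induction on the leading exponent: a multiple differs from the chosen one at the
  -- same exponent by smaller multiples.
  have claim : ∀ (s : ord.syn) (v : σ →₀ ℕ) (i : ι), ord.toSyn (v + ord.degree (b i)) = s →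
      monomial v 1 * b i ∈ Submodule.span R (Set.range e) := by
    intro s
    induction s using WellFoundedLT.induction with
    | ind s ih =>
    intro v i hs
    let u : U := ⟨v + ord.degree (b i), i, le_add_self⟩
    have hb := h i (k u) u le_add_self (hk u)
    have hsub : ord.below b u ≤ Submodule.span R (Set.range e) := by
      refine Submodule.span_le.mpr ?_
      rintro _ ⟨v', j, hlt, rfl⟩
      exact ih _ (hs ▸ hlt) v' j rfl
    have hu : e u ∈ Submodule.span R (Set.range e) := Submodule.subset_span ⟨u, rfl⟩
    have h1 := Submodule.add_mem _ (hsub hb) hu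
    rw [sub_add_cancel] at h1
    have hv : (u : σ →₀ ℕ) - ord.degree (b i) = v := add_tsub_cancel_right _ _
    rwa [hv] at h1
  obtain ⟨c, rfl⟩ := (Ideal.mem_span_range_iff_exists_fun).mp hf
  refine exists_degree_eq_of_mem_span em ed (Submodule.sum_mem _ fun i _ => ?_) h0
  exact mul_mem_of_monomial_mul_mem _ (c i) fun d _ => claim _ d i rfl

theorem isGroebnerBasis_range [Nontrivial R] [Fintype ι] (hm : ∀ i, ord.Monic (b i))
    (h : ∀ i j u, ord.degree (b i) ≤ u → ord.degree (b j) ≤ u → ord.CongrBelow b u i j) :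
    IsGroebnerBasis ord (Set.range b) (Ideal.span (Set.range b)) := by
  refine ⟨Set.finite_range b, ?_, Ideal.subset_span, ?_⟩
  · rintro _ ⟨i, rfl⟩
    exact (hm i).ne_zero
  · refine le_antisymm (Ideal.span_mono (Set.image_mono Ideal.subset_span)) ?_
    refine Ideal.span_le.mpr ?_
    rintro _ ⟨f, hf, rfl⟩
    by_cases h0 : f = 0
    · rw [h0, leadingTerm_zero]
      exact Ideal.zero_mem _
    · obtain ⟨i, hi⟩ := exists_degree_le_of_mem_span hm h hf h0
      have e : ord.leadingTerm f = monomial (ord.degree f - ord.degree (b i)) (ord.leadingCoeff f) *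
          ord.leadingTerm (b i) := by
        rw [leadingTerm, leadingTerm, monomial_mul, (hm i).leadingCoeff_eq_one, mul_one,
          tsub_add_cancel_of_le hi]
      rw [SetLike.mem_coe, e]
      exact Ideal.mul_mem_left _ _ (Ideal.subset_span ⟨b i, ⟨i, rfl⟩, rfl⟩)

end MonomialOrder

/-! ### Comparing exponents in the graded order of the even cycle. -/

namespace MonomialOrder

theorem degLex_lt_of_degree_lt {σ : Type*} [LinearOrder σ] [WellFoundedGT σ] {a b : σ →₀ ℕ}
    (h : a.degree < b.degree) :
    (degLex (σ := σ)).toSyn a < (degLex (σ := σ)).toSyn b :=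
  degLex_lt_iff.mpr (Finsupp.DegLex.lt_iff.mpr (Or.inl h))

theorem degLex_lt_of_apply_lt {σ : Type*} [LinearOrder σ] [WellFoundedGT σ] {a b : σ →₀ ℕ}
    (h : a.degree = b.degree) (s : σ) (hs : ∀ t < s, a t = b t) (hlt : a s < b s) :
    (degLex (σ := σ)).toSyn a < (degLex (σ := σ)).toSyn b :=
  degLex_lt_iff.mpr (Finsupp.DegLex.lt_iff.mpr (Or.inr ⟨h, s, hs, hlt⟩))

end MonomialOrder

theorem evenCycleDegLex_lt_of_degree_lt {m : ℕ} {a b : Fin (2 * m) →₀ ℕ}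
    (h : a.degree < b.degree) :
    (evenCycleDegLex m).toSyn a < (evenCycleDegLex m).toSyn b :=
  @MonomialOrder.degLex_lt_of_degree_lt _ (evenCycleIndexOrder m)
    (@Finite.to_wellFoundedGT (Fin (2 * m)) inferInstance (evenCycleIndexOrder m).toPreorder) a b h

/-- In degree at most that of `b`, an exponent with fewer factors `x_{m-1}`, or as many of these
and fewer factors `x_m`, is smaller. -/
theorem evenCycleDegLex_lt {m : ℕ} (hm : 3 ≤ m) {a b : Fin (2 * m) →₀ ℕ}
    (h : a.degree ≤ b.degree)
    (hs : a ⟨m - 1, by omega⟩ < b ⟨m - 1, by omega⟩ ∨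
      a ⟨m - 1, by omega⟩ = b ⟨m - 1, by omega⟩ ∧ a ⟨m, by omega⟩ < b ⟨m, by omega⟩) :
    (evenCycleDegLex m).toSyn a < (evenCycleDegLex m).toSyn b := by
  rcases h.lt_or_eq with h | h
  · exact evenCycleDegLex_lt_of_degree_lt h
  have rank_lt : ∀ s t : Fin (2 * m), (evenCycleIndexOrder m).lt t s ↔
      evenCycleRank m t < evenCycleRank m s := fun s t => Iff.rfl
  rcases hs with hs | ⟨he, hs⟩
  · refine @MonomialOrder.degLex_lt_of_apply_lt _ (evenCycleIndexOrder m)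
      (@Finite.to_wellFoundedGT (Fin (2 * m)) inferInstance (evenCycleIndexOrder m).toPreorder)
      a b h _ (fun t ht => ?_) hs
    have := (rank_lt _ _).mp ht
    unfold evenCycleRank at this
    simp only at this
    split_ifs at this <;> omega
  · refine @MonomialOrder.degLex_lt_of_apply_lt _ (evenCycleIndexOrder m)
      (@Finite.to_wellFoundedGT (Fin (2 * m)) inferInstance (evenCycleIndexOrder m).toPreorder)
      a b h _ (fun t ht => ?_) hs
    have ht' := (rank_lt _ _).mp ht
    have : t = ⟨m - 1, by omega⟩ := by
      unfold evenCycleRank at ht'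
      simp only at ht'
      ext
      split_ifs at ht' <;> simp only <;> omega
    rw [this, he]

/-! ### Exponents of cyclic windows, and indices modulo n. -/

/-- The exponent of the product of the `k` cyclically consecutive variables that follow `x_c`. -/
noncomputable def windowExp (n : ℕ) [NeZero n] (c k : ℕ) : Fin n →₀ ℕ :=
  ∑ t ∈ Finset.range k, Finsupp.single (Fin.ofNat n (c + 1 + t)) 1

theorem windowExp_zero (n : ℕ) [NeZero n] (c : ℕ) : windowExp n c 0 = 0 := rfl

theorem windowExp_succ (n : ℕ) [NeZero n] (c k : ℕ) :
    windowExp n c (k + 1) = windowExp n c k + Finsupp.single (Fin.ofNat n (c + 1 + k)) 1 :=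
  Finset.sum_range_succ _ _

theorem degree_windowExp (n : ℕ) [NeZero n] (c k : ℕ) : (windowExp n c k).degree = k := by
  simp [windowExp]

theorem windowExp_apply (n : ℕ) [NeZero n] {c k : ℕ} (hc : c < n) (hk : k ≤ n) (j : Fin n) :
    windowExp n c k j =
      if (c + 1 ≤ j ∧ (j : ℕ) ≤ c + k) ∨ (j : ℕ) + n ≤ c + k then 1 else 0 := by
  have hj := j.2
  induction k with
  | zero =>
    rw [windowExp_zero, if_neg (by omega)]
    rfl
  | succ k ih =>
    rw [windowExp_succ, Finsupp.add_apply, ih (by omega), Finsupp.single_apply]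
    have e : Fin.ofNat n (c + 1 + k) = j ↔ (c + 1 + k = j ∨ c + 1 + k = j + n) := by
      rw [Fin.ext_iff, Fin.val_ofNat]
      rcases lt_or_ge (c + 1 + k) n with h | h
      · rw [Nat.mod_eq_of_lt h]
        omega
      · rw [Nat.mod_eq_sub_mod h, Nat.mod_eq_of_lt (by omega)]
        omega
    simp only [e]
    split_ifs <;> omega

theorem single_ofNat_apply (n : ℕ) [NeZero n] {c : ℕ} (hc : c < 2 * n) (j : Fin n) :
    Finsupp.single (Fin.ofNat n c) 1 j = if c = j ∨ c = j + n then 1 else 0 := by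
  have hj := j.2
  rw [Finsupp.single_apply]
  congr 1
  rw [Fin.ext_iff, Fin.val_ofNat]
  rcases lt_or_ge c n with h | h
  · rw [Nat.mod_eq_of_lt h, eq_iff_iff]
    omega
  · rw [Nat.mod_eq_sub_mod h, Nat.mod_eq_of_lt (by omega), eq_iff_iff]
    omega

theorem Fin.ofNat_add_one_val (n : ℕ) [NeZero n] (k : ℕ) :
    (Fin.ofNat n (k + 1) : ℕ) = if k % n + 1 = n then 0 else k % n + 1 := by
  have h0 : 0 < n := Nat.pos_of_ne_zero (NeZero.ne n)
  have h := Nat.mod_lt k h0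
  rw [Fin.val_ofNat, ← Nat.mod_add_mod]
  split_ifs with h1
  · rw [h1, Nat.mod_self]
  · exact Nat.mod_eq_of_lt (by omega)

theorem Fin.ofNat_eq_ofNat_iff (n : ℕ) [NeZero n] (a b : ℕ) :
    Fin.ofNat n a = Fin.ofNat n b ↔ a ≡ b [MOD n] := by
  rw [Fin.ext_iff, Fin.val_ofNat, Fin.val_ofNat]
  rfl

theorem Fin.ofNat_add_self (n : ℕ) [NeZero n] (a : ℕ) : Fin.ofNat n (a + n) = Fin.ofNat n a := by
  rw [Fin.ofNat_eq_ofNat_iff, Nat.ModEq, Nat.add_mod_right]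

theorem Fin.ofNat_add_ne (n : ℕ) [NeZero n] (a : ℕ) {t : ℕ} (h0 : 0 < t) (ht : t < n) :
    Fin.ofNat n (a + t) ≠ Fin.ofNat n a := by
  rw [Ne, Fin.ofNat_eq_ofNat_iff]
  intro h
  have h' : a + t ≡ a + 0 [MOD n] := h
  have := (Nat.ModEq.add_left_cancel' a h').eq_of_lt_of_lt ht (by omega)
  omega

/-! ### The adjugate of the cycle Laplacian and its three-term relation. -/

section Cycle

open MvPolynomial

theorem SimpleGraph.cycleGraph_adj_ofNat {n : ℕ} [NeZero n] (hn : 3 ≤ n) (k : ℕ) (w : Fin n) :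
    (SimpleGraph.cycleGraph n).Adj (Fin.ofNat n (k + 1)) w ↔
      w = Fin.ofNat n k ∨ w = Fin.ofNat n (k + 2) := by
  have h0 : 0 < n := by omega
  have hk := Nat.mod_lt k h0
  have h1 := Fin.ofNat_add_one_val n k
  have h2 := Fin.ofNat_add_one_val n (k + 1)
  have h1' : (k + 1) % n = if k % n + 1 = n then 0 else k % n + 1 := h1
  rw [h1'] at h2
  rw [SimpleGraph.cycleGraph_adj', Fin.ext_iff, Fin.ext_iff, h2, Fin.val_ofNat]
  generalize Fin.ofNat n (k + 1) = u at *
  have hw := w.2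
  have hu := u.2
  rcases lt_trichotomy (u : ℕ) w with h | h | h
  · rw [Fin.coe_sub_iff_le.mpr (Fin.le_def.mpr h.le), Fin.coe_sub_iff_lt.mpr (Fin.lt_def.mpr h)]
    split_ifs at h1 h2 ⊢ <;> omega
  · have : u = w := Fin.ext h
    subst this
    rw [Fin.coe_sub_iff_le.mpr le_rfl]
    split_ifs at h1 h2 ⊢ <;> omega
  · rw [Fin.coe_sub_iff_le.mpr (Fin.le_def.mpr h.le), Fin.coe_sub_iff_lt.mpr (Fin.lt_def.mpr h)]
    split_ifs at h1 h2 ⊢ <;> omega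

variable (R : Type*) [CommRing R]

theorem genLaplacian_cycleGraph_mulVec {n : ℕ} [NeZero n] (hn : 3 ≤ n)
    (f : Fin n → MvPolynomial (Fin n) R) (k : ℕ) :
    (genLaplacian R (SimpleGraph.cycleGraph n)).mulVec f (Fin.ofNat n (k + 1)) =
      X (Fin.ofNat n (k + 1)) * f (Fin.ofNat n (k + 1)) - f (Fin.ofNat n k) -
        f (Fin.ofNat n (k + 2)) := by
  have h1 := Fin.ofNat_add_ne n k (t := 1) (by omega) (by omega)
  -- This needs n ≥ 3: the two neighbours of k + 1 are distinct.
  have h2 := Fin.ofNat_add_ne n k (t := 2) (by omega) (by omega)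
  have h3 := Fin.ofNat_add_ne n (k + 1) (t := 1) (by omega) (by omega)
  have entry : ∀ w, genLaplacian R (SimpleGraph.cycleGraph n) (Fin.ofNat n (k + 1)) w * f w =
      (if w = Fin.ofNat n (k + 1) then X (Fin.ofNat n (k + 1)) * f w else 0) -
        (if w = Fin.ofNat n k then f w else 0) - (if w = Fin.ofNat n (k + 2) then f w else 0) := by
    intro w
    rw [genLaplacian, Matrix.of_apply]
    simp only [SimpleGraph.cycleGraph_adj_ofNat hn]
    by_cases e1 : w = Fin.ofNat n (k + 1)
    · rw [if_pos e1.symm, if_pos e1, if_neg (by rw [e1]; exact h1), if_neg (by rw [e1]; exact h3.symm)]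
      ring
    · rw [if_neg (Ne.symm e1), if_neg e1]
      by_cases e2 : w = Fin.ofNat n k
      · rw [if_pos (Or.inl e2), if_pos e2, if_neg (by rw [e2]; exact h2.symm)]
        ring
      · rw [if_neg e2]
        by_cases e3 : w = Fin.ofNat n (k + 2)
        · rw [if_pos (Or.inr e3), if_pos e3]
          ring
        · rw [if_neg e3, if_neg (by tauto)]
          ring
  rw [Matrix.mulVec, dotProduct]
  simp only [entry, Finset.sum_sub_distrib, Finset.sum_ite_eq', Finset.mem_univ, if_true]

/-- The entry `(i, j)` of the adjugate of `L(C_n, X)`, with `i` and `j` read modulo `n`. -/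
noncomputable def cycleAdj (n : ℕ) [NeZero n] (i j : ℕ) : MvPolynomial (Fin n) R :=
  (genLaplacian R (SimpleGraph.cycleGraph n)).adjugate (Fin.ofNat n i) (Fin.ofNat n j)

theorem genLaplacian_transpose {V : Type*} [DecidableEq V] (G : SimpleGraph V)
    [DecidableRel G.Adj] : (genLaplacian R G).transpose = genLaplacian R G := by
  ext u v : 2
  simp only [Matrix.transpose_apply, genLaplacian, Matrix.of_apply]
  by_cases h : u = v
  · subst h; rfl
  · simp only [if_neg h, if_neg (Ne.symm h), G.adj_comm]

theorem cycleAdj_comm (n : ℕ) [NeZero n] (i j : ℕ) : cycleAdj R n i j = cycleAdj R n j i := by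
  rw [cycleAdj, cycleAdj]
  conv_lhs => rw [← genLaplacian_transpose, ← Matrix.adjugate_transpose, Matrix.transpose_apply]

theorem cycleAdj_congr (n : ℕ) [NeZero n] {i j i' j' : ℕ} (hi : i ≡ i' [MOD n])
    (hj : j ≡ j' [MOD n]) : cycleAdj R n i j = cycleAdj R n i' j' := by
  rw [cycleAdj, cycleAdj, (Fin.ofNat_eq_ofNat_iff n i i').mpr hi,
    (Fin.ofNat_eq_ofNat_iff n j j').mpr hj]

theorem X_mul_cycleAdj {n : ℕ} [NeZero n] (hn : 3 ≤ n) {i j : ℕ} (h : ¬ i + 1 ≡ j [MOD n]) :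
    X (Fin.ofNat n (i + 1)) * cycleAdj R n (i + 1) j =
      cycleAdj R n i j + cycleAdj R n (i + 2) j := by
  have key := congrFun (congrFun (Matrix.mul_adjugate
    (genLaplacian R (SimpleGraph.cycleGraph n))) (Fin.ofNat n (i + 1))) (Fin.ofNat n j)
  rw [Matrix.smul_apply, Matrix.one_apply_ne (by rwa [Ne, Fin.ofNat_eq_ofNat_iff]),
    smul_zero] at key
  have := genLaplacian_cycleGraph_mulVec R hn (fun w =>
    (genLaplacian R (SimpleGraph.cycleGraph n)).adjugate w (Fin.ofNat n j)) i
  have e : (genLaplacian R (SimpleGraph.cycleGraph n)).mulVec (fun w =>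
    (genLaplacian R (SimpleGraph.cycleGraph n)).adjugate w (Fin.ofNat n j)) (Fin.ofNat n (i + 1)) =
    0 := key
  rw [e] at this
  simp only [cycleAdj]
  linear_combination -this

/-! ### Continuants, arc sums and their link with the adjugate. -/

/-- The continuants of a sequence: the determinants of the tridiagonal matrices with diagonal
`y 1, …, y (k - 1)` and off-diagonal entries `-1`. -/
def pathContinuant {A : Type*} [CommRing A] (y : ℕ → A) : ℕ → A
  | 0 => 0
  | 1 => 1
  | k + 2 => y (k + 1) * pathContinuant y (k + 1) - pathContinuant y k

theorem pathContinuant_reverse_recurrence {A : Type*} [CommRing A] (y : ℕ → A) {n t : ℕ}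
    (ht : t + 1 < n) :
    pathContinuant (fun k => y (n - k)) (n - t) =
      y (t + 1) * pathContinuant (fun k => y (n - k)) (n - (t + 1)) -
        pathContinuant (fun k => y (n - k)) (n - (t + 2)) := by
  obtain ⟨s, rfl⟩ : ∃ s, n = t + 2 + s := ⟨n - (t + 2), by omega⟩
  have e1 : t + 2 + s - t = s + 2 := by omega
  have e2 : t + 2 + s - (t + 1) = s + 1 := by omega
  have e3 : t + 2 + s - (t + 2) = s := by omega
  have e4 : t + 2 + s - (s + 1) = t + 1 := by omega
  rw [e1, e2, e3, pathContinuant, e4]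

theorem pathContinuant_reverse {A : Type*} [CommRing A] (y : ℕ → A) {n : ℕ} (hn : 0 < n) :
    pathContinuant (fun k => y (n - k)) n = pathContinuant y n := by
  -- The forward and reversed continuants solve the same second-order recurrence, so their discrete
  -- Wronskian is constant. Its values at t = 0 and t = n - 1 are the two sides.
  have wronskian : ∀ t, t < n →
      pathContinuant y (t + 1) * pathContinuant (fun k => y (n - k)) (n - t) -
        pathContinuant y t * pathContinuant (fun k => y (n - k)) (n - (t + 1)) =
      pathContinuant (fun k => y (n - k)) n := by
    intro t
    induction t with
    | zero => intro _; simp [pathContinuant]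
    | succ t ih =>
      intro ht
      rw [← ih (by omega), pathContinuant_reverse_recurrence y ht, pathContinuant]
      ring
  have h := wronskian (n - 1) (by omega)
  have e1 : n - 1 + 1 = n := by omega
  have e2 : n - (n - 1) = 1 := by omega
  rw [e1, e2, Nat.sub_self] at h
  rw [← h]
  simp [pathContinuant]

/-- The sum of the continuants of the two arcs of a cycle of length `n` that are cut out by the
positions `0` and `t`. -/
def arcSum {A : Type*} [CommRing A] (y : ℕ → A) (n t : ℕ) : A :=
  pathContinuant y t + pathContinuant (fun k => y (n - k)) (n - t)

theorem arcSum_recurrence {A : Type*} [CommRing A] (y : ℕ → A) {n t : ℕ} (ht : t + 1 < n) :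
    y (t + 1) * arcSum y n (t + 1) = arcSum y n t + arcSum y n (t + 2) := by
  rw [arcSum, arcSum, arcSum, pathContinuant_reverse_recurrence y ht, pathContinuant]
  ring

theorem arcSum_zero {A : Type*} [CommRing A] (y : ℕ → A) {n : ℕ} (hn : 0 < n) :
    arcSum y n 0 = pathContinuant y n := by
  rw [arcSum, Nat.sub_zero, pathContinuant_reverse y hn, pathContinuant, zero_add]

theorem arcSum_self {A : Type*} [CommRing A] (y : ℕ → A) (n : ℕ) :
    arcSum y n n = pathContinuant y n := by
  rw [arcSum, Nat.sub_self, pathContinuant, add_zero]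

/-- As a vector on the cycle based at c, the arc sums satisfy the three-term recurrence at every
vertex except c and close up after n steps. Hence L maps the vector to a multiple of the unit vector
at c, and applying adj L gives the identity. -/
theorem det_mul_arcSum {n : ℕ} [NeZero n] (hn : 3 ≤ n) {c t : ℕ} (hc : c < n) (ht : t < n)
    {y : ℕ → MvPolynomial (Fin n) R} (hy : ∀ k, y k = X (Fin.ofNat n (c + k))) :
    (genLaplacian R (SimpleGraph.cycleGraph n)).det * arcSum y n t =
      (y 0 * arcSum y n 0 - arcSum y n 1 - arcSum y n (n - 1)) * cycleAdj R n (c + t) c := by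
  set L := genLaplacian R (SimpleGraph.cycleGraph n) with hL
  let f : Fin n → MvPolynomial (Fin n) R := fun w => arcSum y n ((w + n - c) % n)
  have f_lt : ∀ t < n, f (Fin.ofNat n (c + t)) = arcSum y n t := by
    intro t ht
    have e : ((Fin.ofNat n (c + t) : ℕ) + n - c) % n = t := by
      rw [Fin.val_ofNat]
      rcases lt_or_ge (c + t) n with h | h
      · rw [Nat.mod_eq_of_lt h, Nat.mod_eq_sub_mod (by omega), Nat.mod_eq_of_lt (by omega)]
        omega
      · rw [Nat.mod_eq_sub_mod h, Nat.mod_eq_of_lt (show c + t - n < n by omega),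
          Nat.mod_eq_of_lt (by omega)]
        omega
    simp only [f, e]
  have f_le : ∀ t ≤ n, f (Fin.ofNat n (c + t)) = arcSum y n t := by
    intro t ht
    rcases ht.lt_or_eq with h | rfl
    · exact f_lt t h
    · rw [Fin.ofNat_add_self, arcSum_self, ← arcSum_zero y (by omega)]
      exact f_lt 0 (by omega)
  have hLf : L.mulVec f =
      Pi.single (Fin.ofNat n c) (y 0 * arcSum y n 0 - arcSum y n 1 - arcSum y n (n - 1)) := by
    ext1 w
    obtain ⟨s, hs, rfl⟩ : ∃ s < n, w = Fin.ofNat n (c + s) := by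
      refine ⟨(w + (n - c)) % n, Nat.mod_lt _ (by omega), ?_⟩
      rw [Fin.ext_iff, Fin.val_ofNat, Nat.add_mod_mod]
      have e : c + ((w : ℕ) + (n - c)) = w + n := by omega
      rw [e, Nat.add_mod_right, Nat.mod_eq_of_lt w.2]
    rcases Nat.eq_zero_or_pos s with rfl | h0
    · have e1 : Fin.ofNat n (c + 0) = Fin.ofNat n (c + (n - 1) + 1) := by
        rw [show c + (n - 1) + 1 = c + 0 + n by omega, Fin.ofNat_add_self]
      have e2 : Fin.ofNat n (c + (n - 1) + 2) = Fin.ofNat n (c + 1) := by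
        rw [show c + (n - 1) + 2 = c + 1 + n by omega, Fin.ofNat_add_self]
      rw [e1, hL, genLaplacian_cycleGraph_mulVec R hn, e2, f_le _ (by omega), f_le _ (by omega),
        ← e1, f_le _ (by omega), hy 0, add_zero, Pi.single_eq_same]
      ring
    · obtain ⟨r, rfl⟩ : ∃ r, s = r + 1 := ⟨s - 1, by omega⟩
      rw [Pi.single_eq_of_ne (Fin.ofNat_add_ne n c h0 hs), ← add_assoc, hL,
        genLaplacian_cycleGraph_mulVec R hn, add_assoc, add_assoc, f_le _ (by omega),
        f_le _ (by omega), f_le _ (by omega), ← hy, arcSum_recurrence y hs]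
      ring
  have key := congrArg (fun v => L.adjugate.mulVec v (Fin.ofNat n (c + t))) hLf
  simp only [Matrix.mulVec_mulVec, Matrix.adjugate_mul, Matrix.smul_mulVec, Matrix.one_mulVec,
    Matrix.mulVec_single, Pi.smul_apply, smul_eq_mul, MulOpposite.smul_eq_mul_unop,
    MulOpposite.unop_op, Matrix.col_apply] at key
  rw [f_lt t ht] at key
  rw [key, cycleAdj, ← hL]
  ring

end Cycle

/-! ### Leading terms of the determinant, the continuants and the adjugate entries. -/

section LeadingTerms

open MvPolynomial

variable {R : Type*} [CommRing R]

namespace MonomialOrder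

variable {σ : Type*} {ord : MonomialOrder σ}

theorem degree_degree_le_totalDegree (f : MvPolynomial σ R) :
    (ord.degree f).degree ≤ f.totalDegree := by
  by_cases h : f = 0
  · simp [h]
  · exact le_totalDegree (ord.degree_mem_support h)

theorem toSyn_degree_lt_of_totalDegree_lt
    (hg : ∀ a b : σ →₀ ℕ, a.degree < b.degree → ord.toSyn a < ord.toSyn b)
    {f : MvPolynomial σ R} {u : σ →₀ ℕ} (h : f.totalDegree < u.degree) :
    ord.toSyn (ord.degree f) < ord.toSyn u :=
  hg _ _ ((degree_degree_le_totalDegree f).trans_lt h)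

theorem degree_mul_of_monic_left [Nontrivial R] {f g : MvPolynomial σ R} (hf : ord.Monic f)
    (hg : g ≠ 0) : ord.degree (f * g) = ord.degree f + ord.degree g := by
  refine degree_mul_of_mul_leadingCoeff_ne_zero ?_
  rw [hf.leadingCoeff_eq_one, one_mul]
  exact ord.leadingCoeff_ne_zero_iff.mpr hg

theorem leadingCoeff_mul_of_monic_left [Nontrivial R] {f g : MvPolynomial σ R}
    (hf : ord.Monic f) (hg : g ≠ 0) : ord.leadingCoeff (f * g) = ord.leadingCoeff g := by
  rw [leadingCoeff_mul_of_mul_leadingCoeff_ne_zero, hf.leadingCoeff_eq_one, one_mul]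
  rw [hf.leadingCoeff_eq_one, one_mul]
  exact ord.leadingCoeff_ne_zero_iff.mpr hg

theorem Monic.sub_of_lt {f g : MvPolynomial σ R} (hf : ord.Monic f)
    (h : ord.toSyn (ord.degree g) < ord.toSyn (ord.degree f)) : ord.Monic (f - g) := by
  rw [Monic, leadingCoeff_sub_of_lt h]
  exact hf

/-- Off-diagonal entries are constants, so in the Leibniz expansion every permutation other than the
identity contributes degree below the number of vertices. -/
theorem monic_det_genLaplacian [Nontrivial R] {V : Type*} [Fintype V] [DecidableEq V]
    {ord : MonomialOrder V}
    (hg : ∀ a b : V →₀ ℕ, a.degree < b.degree → ord.toSyn a < ord.toSyn b)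
    (G : SimpleGraph V) [DecidableRel G.Adj] :
    ord.Monic (genLaplacian R G).det ∧
      ord.degree (genLaplacian R G).det = ∑ i, Finsupp.single i 1 := by
  have entry : ∀ u v : V, (genLaplacian R G u v).totalDegree ≤ if u = v then 1 else 0 := by
    intro u v
    rw [genLaplacian, Matrix.of_apply]
    split_ifs
    · exact (totalDegree_X _).le
    · simp
    · simp
  have hdeg : (∑ i : V, Finsupp.single i 1).degree = Fintype.card V := by
    simp
  have hprod : ∏ i, genLaplacian R G i i = monomial (∑ i, Finsupp.single i 1) 1 := by
    rw [monomial_sum_one]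
    refine Finset.prod_congr rfl fun i _ => ?_
    rw [genLaplacian, Matrix.of_apply, if_pos rfl]
    rfl
  have hrest : (∑ τ ∈ Finset.univ.erase (1 : Equiv.Perm V),
      ((Equiv.Perm.sign τ : ℤ) : MvPolynomial V R) *
        ∏ i, genLaplacian R G (τ i) i).totalDegree < Fintype.card V ∨
      (∑ τ ∈ Finset.univ.erase (1 : Equiv.Perm V),
      ((Equiv.Perm.sign τ : ℤ) : MvPolynomial V R) *
        ∏ i, genLaplacian R G (τ i) i) = 0 := by
    by_cases hV : Fintype.card V = 0
    · right
      have := Fintype.card_eq_zero_iff.mp hV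
      refine Finset.sum_eq_zero fun τ hτ => ?_
      exact absurd (Subsingleton.elim _ _) (Finset.ne_of_mem_erase hτ)
    left
    refine (totalDegree_finsetSum_le (d := Fintype.card V - 1) fun τ hτ => ?_).trans_lt (by omega)
    refine (totalDegree_mul _ _).trans ?_
    have h1 : ((Equiv.Perm.sign τ : ℤ) : MvPolynomial V R).totalDegree = 0 := by
      rw [← map_intCast (C : R →+* MvPolynomial V R), totalDegree_C]
    rw [h1, zero_add]
    refine (totalDegree_finsetProd _ _).trans ?_
    refine (Finset.sum_le_sum fun i _ => entry (τ i) i).trans ?_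
    rw [← Finset.card_filter]
    obtain ⟨i, hi⟩ : ∃ i, τ i ≠ i := by
      by_contra! h
      exact Finset.ne_of_mem_erase hτ (Equiv.ext h)
    have : (Finset.univ.filter fun i => τ i = i) ⊂ Finset.univ :=
      Finset.filter_ssubset.mpr ⟨i, Finset.mem_univ _, hi⟩
    have := Finset.card_lt_card this
    rw [Finset.card_univ] at this
    omega
  have hdet : (genLaplacian R G).det = monomial (∑ i, Finsupp.single i 1) 1 +
      ∑ τ ∈ Finset.univ.erase (1 : Equiv.Perm V), ((Equiv.Perm.sign τ : ℤ) : MvPolynomial V R) *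
        ∏ i, genLaplacian R G (τ i) i := by
    rw [Matrix.det_apply', ← Finset.add_sum_erase _ _ (Finset.mem_univ (1 : Equiv.Perm V)), ← hprod]
    simp
  have hm : ord.degree (monomial (∑ i : V, Finsupp.single i 1) (1 : R)) =
      ∑ i : V, Finsupp.single i 1 := by
    classical
    rw [degree_monomial, if_neg one_ne_zero]
  rcases hrest with hlt | h0
  · have hlt' := toSyn_degree_lt_of_totalDegree_lt hg (hdeg ▸ hlt)
    rw [← hm] at hlt'
    rw [hdet]
    exact ⟨ord.monic_monomial_one.add_of_lt hlt', by rw [degree_add_of_lt hlt', hm]⟩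
  · rw [hdet, h0, add_zero]
    exact ⟨ord.monic_monomial_one, hm⟩

theorem monic_pathContinuant [Nontrivial R]
    (hg : ∀ a b : σ →₀ ℕ, a.degree < b.degree → ord.toSyn a < ord.toSyn b) (s : ℕ → σ) (k : ℕ) :
    ord.Monic (pathContinuant (fun i => (X (s i) : MvPolynomial σ R)) (k + 1)) ∧
      ord.degree (pathContinuant (fun i => (X (s i) : MvPolynomial σ R)) (k + 1)) =
        ∑ i ∈ Finset.range k, Finsupp.single (s (i + 1)) 1 := by
  induction k using Nat.strong_induction_on with
  | _ k ih =>
  rcases k with _ | k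
  · simp [pathContinuant, ord.monic_one]
  obtain ⟨h1, h2⟩ := ih k (by omega)
  have e : ord.degree (X (s (k + 1)) * pathContinuant (fun i => (X (s i) : MvPolynomial σ R))
      (k + 1)) = ∑ i ∈ Finset.range (k + 1), Finsupp.single (s (i + 1)) 1 := by
    rw [degree_mul_of_monic_left ord.monic_X h1.ne_zero, h2, degree_X, Finset.sum_range_succ,
      add_comm]
  have hlt : ord.toSyn (ord.degree (pathContinuant (fun i => (X (s i) : MvPolynomial σ R)) k)) <
      ord.toSyn (ord.degree (X (s (k + 1)) * pathContinuant
        (fun i => (X (s i) : MvPolynomial σ R)) (k + 1))) := by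
    rw [e]
    apply hg
    rcases k with _ | k
    · simp [pathContinuant]
    · rw [(ih k (by omega)).2]
      simp
  rw [pathContinuant]
  refine ⟨Monic.sub_of_lt (ord.monic_X.mul h1) hlt, ?_⟩
  rw [degree_sub_of_lt hlt, e]

theorem degree_degree_pathContinuant_le [Nontrivial R]
    (hg : ∀ a b : σ →₀ ℕ, a.degree < b.degree → ord.toSyn a < ord.toSyn b) (s : ℕ → σ) (k : ℕ) :
    (ord.degree (pathContinuant (fun i => (X (s i) : MvPolynomial σ R)) k)).degree ≤ k - 1 := by
  rcases k with _ | k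
  · simp [pathContinuant]
  · rw [(monic_pathContinuant hg s k).2]
    simp

theorem degree_degree_arcSum_le [Nontrivial R]
    (hg : ∀ a b : σ →₀ ℕ, a.degree < b.degree → ord.toSyn a < ord.toSyn b) (s : ℕ → σ)
    (n t : ℕ) :
    (ord.degree (arcSum (fun i => (X (s i) : MvPolynomial σ R)) n t)).degree ≤
      max (t - 1) (n - t - 1) := by
  by_contra! h
  have h1 := (degree_degree_pathContinuant_le (R := R) hg s t).trans (le_max_left _ (n - t - 1))
  have h2 := (degree_degree_pathContinuant_le (R := R) hg (fun i => s (n - i)) (n - t)).trans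
    (le_max_right (t - 1) _)
  have h3 := hg _ _ (h1.trans_lt h)
  have h4 := hg _ _ (h2.trans_lt h)
  exact absurd (ord.degree_add_le (f := pathContinuant (fun i => (X (s i) : MvPolynomial σ R)) t))
    (not_le.mpr (max_lt h3 h4))

/-- In `det_mul_arcSum` both det L and the scalar factor are monic with leading monomial the product
of all variables. Comparing the two sides transfers the leading term from the arc sum to the
adjugate entry, without computing the latter. -/
theorem degree_cycleAdj [Nontrivial R] {n : ℕ} [NeZero n] (hn : 3 ≤ n) {ord : MonomialOrder (Fin n)}
    (hg : ∀ a b : Fin n →₀ ℕ, a.degree < b.degree → ord.toSyn a < ord.toSyn b)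
    {c t : ℕ} (hc : c < n) (ht : t < n) {u : Fin n →₀ ℕ}
    (h : ord.Monic (arcSum (fun k => (X (Fin.ofNat n (c + k)) : MvPolynomial (Fin n) R)) n t))
    (hu : ord.degree
      (arcSum (fun k => (X (Fin.ofNat n (c + k)) : MvPolynomial (Fin n) R)) n t) = u) :
    ord.Monic (cycleAdj R n (c + t) c) ∧ ord.degree (cycleAdj R n (c + t) c) = u := by
  have key := det_mul_arcSum R hn hc ht (fun _ => rfl)
  set y : ℕ → MvPolynomial (Fin n) R := fun k => X (Fin.ofNat n (c + k)) with hy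
  obtain ⟨d1, d2⟩ := monic_det_genLaplacian (R := R) hg (SimpleGraph.cycleGraph n)
  obtain ⟨p1, p2⟩ := monic_pathContinuant (R := R) hg (fun k => Fin.ofNat n (c + k)) (n - 1)
  rw [show n - 1 + 1 = n by omega] at p1 p2
  rw [← hy] at p1 p2
  have e0 : ord.degree (y 0 * arcSum y n 0) = ∑ i, Finsupp.single i 1 := by
    rw [arcSum_zero y (by omega), degree_mul_of_monic_left ord.monic_X p1.ne_zero, p2, degree_X]
    have hw : ∑ i ∈ Finset.range (n - 1), Finsupp.single (Fin.ofNat n (c + (i + 1))) 1 =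
        windowExp n c (n - 1) :=
      Finset.sum_congr rfl fun i _ => by rw [add_comm i 1, add_assoc]
    rw [hw]
    ext j
    have hj := j.2
    rw [Finsupp.add_apply, single_ofNat_apply n (by omega), windowExp_apply n hc (by omega),
      Finsupp.finsetSum_apply, Finset.sum_eq_single j (fun i _ h => Finsupp.single_eq_of_ne h.symm)
        (by simp), Finsupp.single_eq_same]
    split_ifs <;> omega
  have m0 : ord.Monic (y 0 * arcSum y n 0) := by
    rw [arcSum_zero y (by omega)]
    exact ord.monic_X.mul p1
  have hn' : (∑ i : Fin n, Finsupp.single i 1).degree = n := by simp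
  have lt1 : ord.toSyn (ord.degree (arcSum y n 1)) < ord.toSyn (∑ i, Finsupp.single i 1) := by
    apply hg
    have := degree_degree_arcSum_le (R := R) hg (fun k => Fin.ofNat n (c + k)) n 1
    rw [hn']
    refine this.trans_lt ?_
    omega
  have lt2 : ord.toSyn (ord.degree (arcSum y n (n - 1))) <
      ord.toSyn (∑ i, Finsupp.single i 1) := by
    apply hg
    have := degree_degree_arcSum_le (R := R) hg (fun k => Fin.ofNat n (c + k)) n (n - 1)
    rw [hn']
    refine this.trans_lt ?_
    omega
  have m1 : ord.Monic (y 0 * arcSum y n 0 - arcSum y n 1) := m0.sub_of_lt (e0 ▸ lt1)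
  have e1 : ord.degree (y 0 * arcSum y n 0 - arcSum y n 1) = ∑ i, Finsupp.single i 1 := by
    rw [degree_sub_of_lt (e0 ▸ lt1), e0]
  have m2 : ord.Monic (y 0 * arcSum y n 0 - arcSum y n 1 - arcSum y n (n - 1)) :=
    m1.sub_of_lt (e1 ▸ lt2)
  have e2 : ord.degree (y 0 * arcSum y n 0 - arcSum y n 1 - arcSum y n (n - 1)) =
      ∑ i, Finsupp.single i 1 := by
    rw [degree_sub_of_lt (e1 ▸ lt2), e1]
  have hne : cycleAdj R n (c + t) c ≠ 0 := by
    intro h0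
    rw [h0, mul_zero] at key
    exact (d1.mul h).ne_zero key
  constructor
  · rw [Monic, ← leadingCoeff_mul_of_monic_left m2 hne, ← key,
      leadingCoeff_mul_of_monic_left d1 h.ne_zero]
    exact h
  · have := congrArg ord.degree key
    rw [degree_mul_of_monic_left m2 hne, degree_mul_of_monic_left d1 h.ne_zero, d2, e2, hu] at this
    exact (add_left_cancel this).symm

end MonomialOrder

/-- The number of variables in the leading monomial of the `p`-th element of the basis. -/
def basisLength (m p : ℕ) : ℕ := if p < m then m - 1 else m

variable (R) in
/-- The elements of the Gröbner basis, in the cyclic order of their leading monomials. -/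
noncomputable def cycleBasis (m : ℕ) [NeZero (2 * m)] (p : Fin (2 * m - 1)) :
    MvPolynomial (Fin (2 * m)) R :=
  cycleAdj R (2 * m) (p + (basisLength m p + 1)) p

/-- The arc that follows p carries the leading term of the arc sum. For p ≥ m it has m interior
vertices against m - 2; for p < m the arcs are equally long and the variable order decides. -/
theorem degree_cycleBasis [Nontrivial R] {m : ℕ} [NeZero (2 * m)] (hm : 3 ≤ m)
    (p : Fin (2 * m - 1)) :
    (evenCycleDegLex m).Monic (cycleBasis R m p) ∧
      (evenCycleDegLex m).degree (cycleBasis R m p) =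
        windowExp (2 * m) p (basisLength m p) := by
  have hp := p.2
  have hl : basisLength m p = if (p : ℕ) < m then m - 1 else m := rfl
  have hg : ∀ a b : Fin (2 * m) →₀ ℕ, a.degree < b.degree →
      (evenCycleDegLex m).toSyn a < (evenCycleDegLex m).toSyn b :=
    fun a b h => evenCycleDegLex_lt_of_degree_lt h
  obtain ⟨p1, p2⟩ := MonomialOrder.monic_pathContinuant (R := R) hg
    (fun k => Fin.ofNat (2 * m) (p + k)) (basisLength m p)
  have hw : ∑ i ∈ Finset.range (basisLength m p), Finsupp.single
      (Fin.ofNat (2 * m) (p + (i + 1))) 1 = windowExp (2 * m) p (basisLength m p) :=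
    Finset.sum_congr rfl fun i _ => by rw [add_comm i 1, add_assoc]
  rw [hw] at p2
  have hlt : (evenCycleDegLex m).toSyn ((evenCycleDegLex m).degree
      (pathContinuant (fun i => (X (Fin.ofNat (2 * m) (p + (2 * m - i))) :
        MvPolynomial (Fin (2 * m)) R)) (2 * m - (basisLength m p + 1)))) <
      (evenCycleDegLex m).toSyn (windowExp (2 * m) p (basisLength m p)) := by
    by_cases hpm : (p : ℕ) < m
    · rw [if_pos hpm] at hl
      obtain ⟨-, q2⟩ := MonomialOrder.monic_pathContinuant (R := R) hg
        (fun k => Fin.ofNat (2 * m) (p + (2 * m - k))) (m - 1)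
      have e : 2 * m - (basisLength m p + 1) = m - 1 + 1 := by omega
      have hw' : ∑ i ∈ Finset.range (m - 1), Finsupp.single
          (Fin.ofNat (2 * m) (p + (2 * m - (i + 1)))) 1 = windowExp (2 * m) (p + m) (m - 1) := by
        rw [windowExp, ← Finset.sum_range_reflect]
        refine Finset.sum_congr rfl fun i hi => ?_
        have := Finset.mem_range.mp hi
        congr 2
        omega
      rw [e, q2, hw', hl]
      -- The tie: x_{m-1} lies in the window after p if p ≤ m - 2. For p = m - 1 neither window
      -- contains it, and x_m decides.
      refine evenCycleDegLex_lt hm (by simp [degree_windowExp]) ?_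
      rw [windowExp_apply _ (by omega) (by omega), windowExp_apply _ (by omega) (by omega),
        windowExp_apply _ (by omega) (by omega), windowExp_apply _ (by omega) (by omega)]
      simp only
      split_ifs <;> omega
    · rw [if_neg hpm] at hl
      refine hg _ _ ((MonomialOrder.degree_degree_pathContinuant_le hg
        (fun k => Fin.ofNat (2 * m) (p + (2 * m - k))) _).trans_lt ?_)
      rw [degree_windowExp]
      omega
  rw [← p2] at hlt
  refine MonomialOrder.degree_cycleAdj (by omega) hg (by omega) (by split_ifs at hl <;> omega)
    (p1.add_of_lt hlt) ?_
  rw [arcSum, MonomialOrder.degree_add_of_lt hlt, p2]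

end LeadingTerms

/-! ### S-polynomials of the basis. -/

section Buchberger

open MvPolynomial MonomialOrder

variable (R : Type*) [CommRing R] {m : ℕ} [NeZero (2 * m)]

theorem cycleAdj_opposite_add (p : ℕ) :
    cycleAdj R (2 * m) (p + m + m) (p + m) = cycleAdj R (2 * m) (p + m) p := by
  rw [cycleAdj_comm]
  refine cycleAdj_congr R _ rfl ?_
  rw [Nat.ModEq, add_assoc, ← two_mul, Nat.add_mod_right]

theorem not_modEq_of_lt {n a b : ℕ} (h : a < b) (h' : b < a + n) : ¬ a ≡ b [MOD n] := by
  intro hab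
  have := (Nat.modEq_iff_dvd' h.le).mp hab
  exact absurd (Nat.le_of_dvd (by omega) this) (by omega)

/-- With W_p = a(p+m+2,p), this relation and the next two read x_{p+m} O_p = N_{p+m-1} + N_p,
x_{p+m+1} N_p = O_p + W_p and x_{p+1} N_{p+1} = W_p + O_{p+2}. Eliminating the entries outside the
basis gives all the S-polynomials. -/
theorem X_mul_cycleAdj_opposite (hm : 3 ≤ m) (p : ℕ) :
    X (Fin.ofNat (2 * m) (p + m)) * cycleAdj R (2 * m) (p + m) p =
      cycleAdj R (2 * m) (p + m - 1 + (m + 1)) (p + m - 1) +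
        cycleAdj R (2 * m) (p + (m + 1)) p := by
  have h := X_mul_cycleAdj R (n := 2 * m) (i := p + m - 1) (j := p) (by omega)
    (fun h => not_modEq_of_lt (by omega) (by omega) h.symm)
  have e : cycleAdj R (2 * m) (p + m - 1) p =
      cycleAdj R (2 * m) (p + m - 1 + (m + 1)) (p + m - 1) := by
    rw [cycleAdj_comm]
    refine cycleAdj_congr R _ ?_ rfl
    rw [show p + m - 1 + (m + 1) = p + 2 * m by omega, Nat.ModEq, Nat.add_mod_right]
  rw [show p + m - 1 + 1 = p + m by omega, show p + m - 1 + 2 = p + (m + 1) by omega, e] at h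
  exact h

theorem X_mul_cycleAdj_first (hm : 3 ≤ m) (p : ℕ) :
    X (Fin.ofNat (2 * m) (p + (m + 1))) * cycleAdj R (2 * m) (p + (m + 1)) p =
      cycleAdj R (2 * m) (p + m) p + cycleAdj R (2 * m) (p + m + 2) p :=
  X_mul_cycleAdj R (i := p + m) (j := p) (by omega)
    (fun h => not_modEq_of_lt (by omega) (by omega) h.symm)

theorem X_mul_cycleAdj_second (hm : 3 ≤ m) (p : ℕ) :
    X (Fin.ofNat (2 * m) (p + 1)) * cycleAdj R (2 * m) (p + 1 + (m + 1)) (p + 1) =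
      cycleAdj R (2 * m) (p + m + 2) p + cycleAdj R (2 * m) (p + 2 + m) (p + 2) := by
  have h := X_mul_cycleAdj R (n := 2 * m) (i := p) (j := p + m + 2) (by omega)
    (not_modEq_of_lt (by omega) (by omega))
  rw [cycleAdj_comm R _ (p + 1), cycleAdj_comm R _ p, cycleAdj_comm R _ (p + 2)] at h
  rw [show p + 1 + (m + 1) = p + m + 2 by omega, show p + 2 + m = p + m + 2 by omega]
  exact h

theorem cycleBasis_of_lt {p : ℕ} (h : p < m) :
    cycleBasis R m ⟨p, by omega⟩ = cycleAdj R (2 * m) (p + m) p := by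
  have e : m - 1 + 1 = m := by omega
  simp only [cycleBasis, basisLength, if_pos h, e]

theorem cycleBasis_of_le {p : ℕ} (h : m ≤ p) (h' : p < 2 * m - 1) :
    cycleBasis R m ⟨p, h'⟩ = cycleAdj R (2 * m) (p + (m + 1)) p := by
  simp only [cycleBasis, basisLength, if_neg (not_lt.mpr h)]

/-- The leading exponents of the Gröbner basis of the even cycle. -/
noncomputable def leadExp (m : ℕ) [NeZero (2 * m)] (p : ℕ) : Fin (2 * m) →₀ ℕ :=
  windowExp (2 * m) p (basisLength m p)

theorem leadExp_apply {p : ℕ} (hm : 3 ≤ m) (hp : p < 2 * m - 1) (j : Fin (2 * m)) :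
    leadExp m p j = if (p + 1 ≤ j ∧ (j : ℕ) ≤ p + if p < m then m - 1 else m) ∨
      (j : ℕ) + 2 * m ≤ p + if p < m then m - 1 else m then 1 else 0 := by
  rw [leadExp, windowExp_apply _ (by omega) (by unfold basisLength; split_ifs <;> omega),
    basisLength]

theorem degree_leadExp (p : ℕ) : (leadExp m p).degree = if p < m then m - 1 else m :=
  degree_windowExp _ _ _

variable {R}

theorem degree_cycleBasis_mk [Nontrivial R] (hm : 3 ≤ m) {p : ℕ} (hp : p < 2 * m - 1) :
    (evenCycleDegLex m).degree (cycleBasis R m ⟨p, hp⟩) = leadExp m p :=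
  (degree_cycleBasis hm _).2

theorem mem_below_of_lt [Nontrivial R] (hm : 3 ≤ m) {p : ℕ} (hp : p < m)
    {u : Fin (2 * m) →₀ ℕ} (hu : m - 1 < u.degree) :
    cycleAdj R (2 * m) (p + m) p ∈ (evenCycleDegLex m).below (cycleBasis R m) u := by
  rw [← cycleBasis_of_lt R hp]
  refine mem_below (evenCycleDegLex_lt_of_degree_lt ?_)
  rw [(degree_cycleBasis hm _).2, degree_windowExp, basisLength, if_pos hp]
  exact hu

theorem mem_below_of_le [Nontrivial R] (hm : 3 ≤ m) {p : ℕ} (hp : m ≤ p) (hp' : p < 2 * m - 1)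
    {u : Fin (2 * m) →₀ ℕ} (hu : (evenCycleDegLex m).toSyn (leadExp m p) <
      (evenCycleDegLex m).toSyn u) :
    cycleAdj R (2 * m) (p + (m + 1)) p ∈ (evenCycleDegLex m).below (cycleBasis R m) u := by
  rw [← cycleBasis_of_le R hp hp']
  refine mem_below ?_
  rw [(degree_cycleBasis hm _).2]
  exact hu

theorem X_mul_mem_below_of_lt [Nontrivial R] (hm : 3 ≤ m) {p : ℕ} (hp : p < m) {s : Fin (2 * m)}
    {u : Fin (2 * m) →₀ ℕ} (hu : (evenCycleDegLex m).toSyn (Finsupp.single s 1 + leadExp m p) <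
      (evenCycleDegLex m).toSyn u) :
    X s * cycleAdj R (2 * m) (p + m) p ∈ (evenCycleDegLex m).below (cycleBasis R m) u := by
  rw [← cycleBasis_of_lt R hp]
  refine X_mul_mem_below ?_
  rw [(degree_cycleBasis hm _).2]
  exact hu

theorem X_mul_mem_below_of_le [Nontrivial R] (hm : 3 ≤ m) {p : ℕ} (hp : m ≤ p)
    (hp' : p < 2 * m - 1) {s : Fin (2 * m)} {u : Fin (2 * m) →₀ ℕ}
    (hu : (evenCycleDegLex m).toSyn (Finsupp.single s 1 + leadExp m p) <
      (evenCycleDegLex m).toSyn u) :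
    X s * cycleAdj R (2 * m) (p + (m + 1)) p ∈
      (evenCycleDegLex m).below (cycleBasis R m) u := by
  rw [← cycleBasis_of_le R hp hp']
  refine X_mul_mem_below ?_
  rw [(degree_cycleBasis hm _).2]
  exact hu

theorem X_mul_X_eq_monomial {σ : Type*} (a b : σ) :
    (monomial (Finsupp.single a 1 + Finsupp.single b 1) 1 : MvPolynomial σ R) = X a * X b := by
  rw [X, X, monomial_mul, one_mul]

/-- The S-polynomial of O_p and O_{p+1} is N_{p+m-1} - N_{p+m+1}, because the term N_p cancels. -/
theorem congrBelow_short [Nontrivial R] (hm : 3 ≤ m) {p : ℕ} (hp : p + 1 < m)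
    {u : Fin (2 * m) →₀ ℕ} (h1 : leadExp m p ≤ u) (h2 : leadExp m (p + 1) ≤ u) :
    (evenCycleDegLex m).CongrBelow (cycleBasis R m) u ⟨p, by omega⟩ ⟨p + 1, by omega⟩ := by
  refine CongrBelow.of_le (u₀ := windowExp (2 * m) p m)
    (α := Finsupp.single (Fin.ofNat (2 * m) (p + m)) 1)
    (β := Finsupp.single (Fin.ofNat (2 * m) (p + 1)) 1) ?_ ?_ ?_ ?_
  · intro j
    have hj := j.2
    have h1j := h1 j
    have h2j := h2 j
    rw [leadExp_apply hm (by omega)] at h1j h2j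
    rw [windowExp_apply _ (by omega) (by omega)]
    split_ifs at h1j h2j ⊢ <;> omega
  · rw [degree_cycleBasis_mk hm]
    ext j
    have hj := j.2
    rw [Finsupp.add_apply, single_ofNat_apply _ (by omega),
      windowExp_apply _ (by omega) (by omega)]
    rw [leadExp_apply hm (by omega)]
    split_ifs <;> omega
  · rw [degree_cycleBasis_mk hm]
    ext j
    have hj := j.2
    rw [Finsupp.add_apply, single_ofNat_apply _ (by omega),
      windowExp_apply _ (by omega) (by omega)]
    rw [leadExp_apply hm (by omega)]
    split_ifs <;> omega
  · rw [cycleBasis_of_lt R (by omega), cycleBasis_of_lt R (by omega)]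
    have r1 := X_mul_cycleAdj_opposite R hm p
    have r2 := X_mul_cycleAdj_opposite R hm (p + 1 + m)
    rw [cycleAdj_opposite_add] at r2
    have e1 : Fin.ofNat (2 * m) (p + 1 + m + m) = Fin.ofNat (2 * m) (p + 1) := by
      rw [add_assoc, ← two_mul, Fin.ofNat_add_self]
    have e2 : cycleAdj R (2 * m) (p + 1 + m + m - 1 + (m + 1)) (p + 1 + m + m - 1) =
        cycleAdj R (2 * m) (p + (m + 1)) p := by
      refine cycleAdj_congr R _ ?_ ?_
      · rw [show p + 1 + m + m - 1 + (m + 1) = p + (m + 1) + 2 * m by omega, Nat.ModEq,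
          Nat.add_mod_right]
      · rw [show p + 1 + m + m - 1 = p + 2 * m by omega, Nat.ModEq, Nat.add_mod_right]
    rw [e1, e2] at r2
    have hS : monomial (Finsupp.single (Fin.ofNat (2 * m) (p + m)) 1) 1 *
        cycleAdj R (2 * m) (p + m) p - monomial (Finsupp.single (Fin.ofNat (2 * m) (p + 1)) 1) 1 *
        cycleAdj R (2 * m) (p + 1 + m) (p + 1) =
        cycleAdj R (2 * m) (p + m - 1 + (m + 1)) (p + m - 1) -
          cycleAdj R (2 * m) (p + 1 + m + (m + 1)) (p + 1 + m) := by
      change X _ * _ - X _ * _ = _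
      rw [r1, r2]
      ring
    rw [hS]
    refine Submodule.sub_mem _ ?_ ?_
    -- For p = 0 the term N_{m-1} is not in the basis; it is replaced by x_{2m-1} O_{m-1} -
    -- N_{2m-2}.
    · rcases Nat.eq_zero_or_pos p with rfl | h0
      · have r := X_mul_cycleAdj_opposite R hm (m - 1)
        rw [show m - 1 + m - 1 = 2 * m - 2 by omega] at r
        rw [show 0 + m - 1 = m - 1 by omega, eq_sub_iff_add_eq'.mpr r.symm]
        refine Submodule.sub_mem _ (X_mul_mem_below_of_lt hm (by omega) ?_)
          (mem_below_of_le hm (by omega) (by omega) ?_)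
        · refine evenCycleDegLex_lt hm ?_ (Or.inl ?_)
          · rw [map_add, Finsupp.degree_single, degree_leadExp, degree_windowExp]
            split_ifs <;> omega
          · rw [Finsupp.add_apply, single_ofNat_apply _ (by omega), leadExp_apply hm (by omega),
              windowExp_apply _ (by omega) (by omega)]
            simp only
            split_ifs <;> omega
        · refine evenCycleDegLex_lt hm ?_ (Or.inl ?_)
          · rw [degree_leadExp, degree_windowExp]
            split_ifs <;> omega
          · rw [leadExp_apply hm (by omega), windowExp_apply _ (by omega) (by omega)]
            simp only
            split_ifs <;> omega
      · refine mem_below_of_le hm (by omega) (by omega) (evenCycleDegLex_lt hm ?_ (Or.inl ?_))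
        · rw [degree_leadExp, degree_windowExp]
          split_ifs <;> omega
        · rw [leadExp_apply hm (by omega), windowExp_apply _ (by omega) (by omega)]
          simp only
          split_ifs <;> omega
    · rcases Nat.lt_or_ge (p + 2) m with h0 | h0
      · refine mem_below_of_le hm (by omega) (by omega) (evenCycleDegLex_lt hm ?_ (Or.inl ?_))
        · rw [degree_leadExp, degree_windowExp]
          split_ifs <;> omega
        · rw [leadExp_apply hm (by omega), windowExp_apply _ (by omega) (by omega)]
          simp only
          split_ifs <;> omega
      -- Here p = m - 2, and N_{2m-1} is not in the basis; it is replaced by x_{2m} O_0 - N_m. The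
      -- product x_{2m} O_0 also contains x_{m-1} in its leading monomial, so x_m makes the
      -- comparison.
      · have r := X_mul_cycleAdj_opposite R hm (0 + m)
        rw [cycleAdj_opposite_add, show 0 + m + m - 1 = p + 1 + m by omega] at r
        rw [eq_sub_iff_add_eq.mpr r.symm]
        refine Submodule.sub_mem _ (X_mul_mem_below_of_lt hm (by omega) ?_)
          (mem_below_of_le hm (by omega) (by omega) ?_)
        · refine evenCycleDegLex_lt hm ?_ (Or.inr ⟨?_, ?_⟩)
          · rw [map_add, Finsupp.degree_single, degree_leadExp, degree_windowExp]
            split_ifs <;> omega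
          · rw [Finsupp.add_apply, single_ofNat_apply _ (by omega), leadExp_apply hm (by omega),
              windowExp_apply _ (by omega) (by omega)]
            simp only
            split_ifs <;> omega
          · rw [Finsupp.add_apply, single_ofNat_apply _ (by omega), leadExp_apply hm (by omega),
              windowExp_apply _ (by omega) (by omega)]
            simp only
            split_ifs <;> omega
        · refine evenCycleDegLex_lt hm ?_ (Or.inl ?_)
          · rw [degree_leadExp, degree_windowExp]
            split_ifs <;> omega
          · rw [leadExp_apply hm (by omega), windowExp_apply _ (by omega) (by omega)]
            simp only
            split_ifs <;> omega

/-- Passage from the O's to the N's. The S-polynomial x_{2m} x_{2m-1} O_{m-1} - x_m N_m equals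
x_{2m} N_{2m-2} + O_{m-1} - O_1, since W_{m-1} cancels. -/
theorem congrBelow_middle [Nontrivial R] (hm : 3 ≤ m)
    {u : Fin (2 * m) →₀ ℕ} (h1 : leadExp m (m - 1) ≤ u) (h2 : leadExp m m ≤ u) :
    (evenCycleDegLex m).CongrBelow (cycleBasis R m) u ⟨m - 1, by omega⟩ ⟨m, by omega⟩ := by
  refine CongrBelow.of_le (u₀ := windowExp (2 * m) (m - 1) (m + 1))
    (α := Finsupp.single (Fin.ofNat (2 * m) (2 * m)) 1 +
      Finsupp.single (Fin.ofNat (2 * m) (m - 1 + m)) 1)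
    (β := Finsupp.single (Fin.ofNat (2 * m) (m - 1 + 1)) 1) ?_ ?_ ?_ ?_
  · intro j
    have hj := j.2
    have h1j := h1 j
    have h2j := h2 j
    rw [leadExp_apply hm (by omega)] at h1j h2j
    rw [windowExp_apply _ (by omega) (by omega)]
    split_ifs at h1j h2j ⊢ <;> omega
  · rw [degree_cycleBasis_mk hm]
    ext j
    have hj := j.2
    rw [Finsupp.add_apply, Finsupp.add_apply, single_ofNat_apply _ (by omega),
      single_ofNat_apply _ (by omega), windowExp_apply _ (by omega) (by omega)]
    rw [leadExp_apply hm (by omega)]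
    split_ifs <;> omega
  · rw [degree_cycleBasis_mk hm]
    ext j
    have hj := j.2
    rw [Finsupp.add_apply, single_ofNat_apply _ (by omega),
      windowExp_apply _ (by omega) (by omega)]
    rw [leadExp_apply hm (by omega)]
    split_ifs <;> omega
  · rw [cycleBasis_of_lt R (by omega), cycleBasis_of_le R le_rfl (by omega), X_mul_X_eq_monomial]
    have r1 := X_mul_cycleAdj_opposite R hm (m - 1)
    have r2 := X_mul_cycleAdj_first R hm (m - 1)
    have r3 := X_mul_cycleAdj_second R hm (m - 1)
    rw [show m - 1 + m - 1 = 2 * m - 2 by omega] at r1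
    rw [show Fin.ofNat (2 * m) (m - 1 + (m + 1)) = Fin.ofNat (2 * m) (2 * m) by
      congr 1; omega] at r2
    rw [show m - 1 + 2 = 1 + m by omega, cycleAdj_opposite_add,
      show cycleAdj R (2 * m) (m - 1 + 1 + (m + 1)) (m - 1 + 1) =
        cycleAdj R (2 * m) (m + (m + 1)) m by rw [show m - 1 + 1 = m by omega]] at r3
    have hS : X (Fin.ofNat (2 * m) (2 * m)) * X (Fin.ofNat (2 * m) (m - 1 + m)) *
        cycleAdj R (2 * m) (m - 1 + m) (m - 1) -
        monomial (Finsupp.single (Fin.ofNat (2 * m) (m - 1 + 1)) 1) 1 *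
          cycleAdj R (2 * m) (m + (m + 1)) m =
        X (Fin.ofNat (2 * m) (2 * m)) * cycleAdj R (2 * m) (2 * m - 2 + (m + 1)) (2 * m - 2) +
          cycleAdj R (2 * m) (m - 1 + m) (m - 1) - cycleAdj R (2 * m) (1 + m) 1 := by
      change _ - X _ * _ = _
      rw [r3, mul_assoc, r1]
      linear_combination r2
    rw [hS]
    refine Submodule.sub_mem _ (Submodule.add_mem _ ?_ ?_) ?_
    · refine X_mul_mem_below_of_le hm (by omega) (by omega)
        (evenCycleDegLex_lt hm ?_ (Or.inr ⟨?_, ?_⟩))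
      · rw [map_add, Finsupp.degree_single, degree_leadExp, degree_windowExp]
        split_ifs <;> omega
      · rw [Finsupp.add_apply, single_ofNat_apply _ (by omega), leadExp_apply hm (by omega),
          windowExp_apply _ (by omega) (by omega)]
        simp only
        split_ifs <;> omega
      · rw [Finsupp.add_apply, single_ofNat_apply _ (by omega), leadExp_apply hm (by omega),
          windowExp_apply _ (by omega) (by omega)]
        simp only
        split_ifs <;> omega
    · exact mem_below_of_lt hm (by omega) (by rw [degree_windowExp]; omega)
    · exact mem_below_of_lt hm (by omega) (by rw [degree_windowExp]; omega)

/-- Eliminating W_p leaves O_p - O_{p+2}, which by half-turn periodicity of O is O_{p-m} -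
O_{p-m+2}; its degree is too small to matter. -/
theorem congrBelow_long [Nontrivial R] (hm : 3 ≤ m) {p : ℕ} (hp : m ≤ p) (hp' : p + 1 < 2 * m - 1)
    {u : Fin (2 * m) →₀ ℕ} (h1 : leadExp m p ≤ u) (h2 : leadExp m (p + 1) ≤ u) :
    (evenCycleDegLex m).CongrBelow (cycleBasis R m) u ⟨p, by omega⟩ ⟨p + 1, by omega⟩ := by
  refine CongrBelow.of_le (u₀ := windowExp (2 * m) p (m + 1))
    (α := Finsupp.single (Fin.ofNat (2 * m) (p + (m + 1))) 1)
    (β := Finsupp.single (Fin.ofNat (2 * m) (p + 1)) 1) ?_ ?_ ?_ ?_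
  · intro j
    have hj := j.2
    have h1j := h1 j
    have h2j := h2 j
    rw [leadExp_apply hm (by omega)] at h1j h2j
    rw [windowExp_apply _ (by omega) (by omega)]
    split_ifs at h1j h2j ⊢ <;> omega
  · rw [degree_cycleBasis_mk hm]
    ext j
    have hj := j.2
    rw [Finsupp.add_apply, single_ofNat_apply _ (by omega),
      windowExp_apply _ (by omega) (by omega)]
    rw [leadExp_apply hm (by omega)]
    split_ifs <;> omega
  · rw [degree_cycleBasis_mk hm]
    ext j
    have hj := j.2
    rw [Finsupp.add_apply, single_ofNat_apply _ (by omega),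
      windowExp_apply _ (by omega) (by omega)]
    rw [leadExp_apply hm (by omega)]
    split_ifs <;> omega
  · rw [cycleBasis_of_le R hp (by omega), cycleBasis_of_le R (by omega) hp']
    obtain ⟨q, rfl⟩ : ∃ q, p = q + m := ⟨p - m, by omega⟩
    have r1 := X_mul_cycleAdj_first R hm (q + m)
    have r2 := X_mul_cycleAdj_second R hm (q + m)
    rw [cycleAdj_opposite_add] at r1
    rw [show q + m + 2 = q + 2 + m by omega, cycleAdj_opposite_add] at r2
    have hS : monomial (Finsupp.single (Fin.ofNat (2 * m) (q + m + (m + 1))) 1) 1 *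
        cycleAdj R (2 * m) (q + m + (m + 1)) (q + m) -
        monomial (Finsupp.single (Fin.ofNat (2 * m) (q + m + 1)) 1) 1 *
        cycleAdj R (2 * m) (q + m + 1 + (m + 1)) (q + m + 1) =
        cycleAdj R (2 * m) (q + m) q - cycleAdj R (2 * m) (q + 2 + m) (q + 2) := by
      change X _ * _ - X _ * _ = _
      rw [r1, r2]
      ring
    rw [hS]
    exact Submodule.sub_mem _ (mem_below_of_lt hm (by omega) (by rw [degree_windowExp]; omega))
      (mem_below_of_lt hm (by omega) (by rw [degree_windowExp]; omega))

/-- The pair that closes the cycle. The S-polynomial x_{m-1} N_{2m-2} - x_{2m-1} x_{2m} O_0 equals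
O_{m-2} - O_0 - x_{2m-1} N_m, since W_{2m-2} cancels. -/
theorem congrBelow_last [Nontrivial R] (hm : 3 ≤ m)
    {u : Fin (2 * m) →₀ ℕ} (h1 : leadExp m (2 * m - 2) ≤ u) (h2 : leadExp m 0 ≤ u) :
    (evenCycleDegLex m).CongrBelow (cycleBasis R m) u ⟨2 * m - 2, by omega⟩ ⟨0, by omega⟩ := by
  refine CongrBelow.of_le (u₀ := windowExp (2 * m) (2 * m - 2) (m + 1))
    (α := Finsupp.single (Fin.ofNat (2 * m) (2 * m - 2 + (m + 1))) 1)
    (β := Finsupp.single (Fin.ofNat (2 * m) (2 * m - 2 + 1)) 1 +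
      Finsupp.single (Fin.ofNat (2 * m) (0 + m + m)) 1) ?_ ?_ ?_ ?_
  · intro j
    have hj := j.2
    have h1j := h1 j
    have h2j := h2 j
    rw [leadExp_apply hm (by omega)] at h1j h2j
    rw [windowExp_apply _ (by omega) (by omega)]
    split_ifs at h1j h2j ⊢ <;> omega
  · rw [degree_cycleBasis_mk hm]
    ext j
    have hj := j.2
    rw [Finsupp.add_apply, single_ofNat_apply _ (by omega),
      windowExp_apply _ (by omega) (by omega)]
    rw [leadExp_apply hm (by omega)]
    split_ifs <;> omega
  · rw [degree_cycleBasis_mk hm]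
    ext j
    have hj := j.2
    rw [Finsupp.add_apply, Finsupp.add_apply, single_ofNat_apply _ (by omega),
      single_ofNat_apply _ (by omega), windowExp_apply _ (by omega) (by omega)]
    rw [leadExp_apply hm (by omega)]
    split_ifs <;> omega
  · rw [cycleBasis_of_le R (by omega) (by omega), cycleBasis_of_lt R (by omega),
      X_mul_X_eq_monomial]
    have r1 := X_mul_cycleAdj_first R hm (2 * m - 2)
    have r2 := X_mul_cycleAdj_second R hm (2 * m - 2)
    have r3 := X_mul_cycleAdj_opposite R hm (0 + m)
    rw [cycleAdj_opposite_add, show 0 + m + m - 1 = 2 * m - 2 + 1 by omega] at r3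
    have e : 2 * m - 2 = m - 2 + m := by omega
    have e1 : cycleAdj R (2 * m) (2 * m - 2 + m) (2 * m - 2) =
        cycleAdj R (2 * m) (m - 2 + m) (m - 2) := by
      rw [e, cycleAdj_opposite_add]
    have e2 : cycleAdj R (2 * m) (2 * m - 2 + 2 + m) (2 * m - 2 + 2) =
        cycleAdj R (2 * m) (0 + m) 0 := by
      rw [show 2 * m - 2 + 2 = 0 + m + m by omega, cycleAdj_opposite_add, cycleAdj_opposite_add]
    rw [e1] at r1
    rw [e2] at r2
    have hS : monomial (Finsupp.single (Fin.ofNat (2 * m) (2 * m - 2 + (m + 1))) 1) 1 *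
        cycleAdj R (2 * m) (2 * m - 2 + (m + 1)) (2 * m - 2) -
        X (Fin.ofNat (2 * m) (2 * m - 2 + 1)) * X (Fin.ofNat (2 * m) (0 + m + m)) *
          cycleAdj R (2 * m) (0 + m) 0 =
        cycleAdj R (2 * m) (m - 2 + m) (m - 2) - cycleAdj R (2 * m) (0 + m) 0 -
          X (Fin.ofNat (2 * m) (2 * m - 2 + 1)) *
            cycleAdj R (2 * m) (0 + m + (m + 1)) (0 + m) := by
      change X _ * _ - _ = _
      rw [r1, mul_assoc, r3]
      linear_combination -r2
    rw [hS]
    refine Submodule.sub_mem _ (Submodule.sub_mem _ ?_ ?_) ?_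
    · exact mem_below_of_lt hm (by omega) (by rw [degree_windowExp]; omega)
    · exact mem_below_of_lt hm (by omega) (by rw [degree_windowExp]; omega)
    · refine X_mul_mem_below_of_le hm (by omega) (by omega)
        (evenCycleDegLex_lt hm ?_ (Or.inl ?_))
      · rw [map_add, Finsupp.degree_single, degree_leadExp, degree_windowExp]
        split_ifs <;> omega
      · rw [Finsupp.add_apply, single_ofNat_apply _ (by omega), leadExp_apply hm (by omega),
          windowExp_apply _ (by omega) (by omega)]
        simp only
        split_ifs <;> omega

theorem congrBelow_succ [Nontrivial R] (hm : 3 ≤ m) {p : ℕ} (hp : p + 1 < 2 * m - 1)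
    {u : Fin (2 * m) →₀ ℕ} (h1 : leadExp m p ≤ u) (h2 : leadExp m (p + 1) ≤ u) :
    (evenCycleDegLex m).CongrBelow (cycleBasis R m) u ⟨p, by omega⟩ ⟨p + 1, hp⟩ := by
  rcases lt_trichotomy (p + 1) m with h | h | h
  · exact congrBelow_short hm h h1 h2
  · obtain rfl : p = m - 1 := by omega
    have e : (⟨m - 1 + 1, hp⟩ : Fin (2 * m - 1)) = ⟨m, by omega⟩ := Fin.ext h
    rw [e]
    rw [h] at h2
    exact congrBelow_middle hm h1 h2
  · exact congrBelow_long hm (by omega) hp h1 h2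

theorem congrBelow_interval [Nontrivial R] (hm : 3 ≤ m) {p d : ℕ} (hp : p + d < 2 * m - 1)
    {u : Fin (2 * m) →₀ ℕ} (h : ∀ r, p ≤ r → r ≤ p + d → leadExp m r ≤ u) :
    (evenCycleDegLex m).CongrBelow (cycleBasis R m) u ⟨p, by omega⟩ ⟨p + d, hp⟩ := by
  induction d with
  | zero => exact CongrBelow.refl _ _
  | succ d ih =>
    exact (ih (by omega) fun r hr hr' => h r hr (by omega)).trans
      (congrBelow_succ (p := p + d) hm hp (h _ (by omega) (by omega)) (h _ (by omega) (by omega)))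

theorem congrBelow_of_lt [Nontrivial R] (hm : 3 ≤ m) {p q : ℕ} (hpq : p < q) (hq : q < 2 * m - 1)
    {u : Fin (2 * m) →₀ ℕ} (h1 : leadExp m p ≤ u) (h2 : leadExp m q ≤ u) :
    (evenCycleDegLex m).CongrBelow (cycleBasis R m) u ⟨p, by omega⟩ ⟨q, hq⟩ := by
  -- The window after p reaches x_q, so every window starting between p and q lies in the union of
  -- the two and divides u.
  by_cases hf : q ≤ p + if p < m then m - 1 else m
  · obtain ⟨d, rfl⟩ : ∃ d, q = p + d := ⟨q - p, by omega⟩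
    refine congrBelow_interval hm hq fun r hr hr' j => ?_
    have hj := j.2
    have h1j := h1 j
    have h2j := h2 j
    rw [leadExp_apply hm (by omega)] at h1j h2j ⊢
    split_ifs at h1j h2j hf ⊢ <;> omega
  -- The window after q wraps around to x_{p+1}; the chain then runs from q up to 2m - 2, across to
  -- 0, and up to p. In the remaining case the windows are disjoint.
  by_cases hb : 2 * m + p + 1 ≤ q + if q < m then m - 1 else m
  · have hr : ∀ r, r < 2 * m - 1 → r ≤ p ∨ q ≤ r → leadExp m r ≤ u := by
      intro r hr hr' j
      have hj := j.2
      have h1j := h1 j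
      have h2j := h2 j
      rw [leadExp_apply hm (by omega)] at h1j h2j ⊢
      split_ifs at h1j h2j hb ⊢ <;> omega
    have c1 := congrBelow_interval (R := R) (u := u) hm (p := 0) (d := p) (by omega)
      fun r _ h => hr r (by omega) (by omega)
    have c2 := congrBelow_interval (R := R) (u := u) hm (p := q) (d := 2 * m - 2 - q) (by omega)
      fun r _ h => hr r (by omega) (by omega)
    have e1 : (⟨0 + p, by omega⟩ : Fin (2 * m - 1)) = ⟨p, by omega⟩ := Fin.ext (zero_add p)
    have e2 : (⟨q + (2 * m - 2 - q), by omega⟩ : Fin (2 * m - 1)) = ⟨2 * m - 2, by omega⟩ :=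
      Fin.ext (by simp only; omega)
    rw [e1] at c1
    rw [e2] at c2
    exact ((c2.trans (congrBelow_last hm (hr _ (by omega) (by omega))
      (hr _ (by omega) (by omega)))).trans c1).symm
  · refine CongrBelow.of_coprime (degree_cycleBasis hm _).1 (degree_cycleBasis hm _).1 (fun j => ?_)
      ?_ ?_
    · rw [degree_cycleBasis_mk hm, degree_cycleBasis_mk hm]
      have hj := j.2
      rw [leadExp_apply hm (by omega), leadExp_apply hm (by omega)]
      split_ifs at hf hb ⊢ <;> omega
    · rw [(degree_cycleBasis hm _).2]
      exact h1
    · rw [(degree_cycleBasis hm _).2]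
      exact h2

theorem isGroebnerBasis_cycleBasis [Nontrivial R] (hm : 3 ≤ m) :
    IsGroebnerBasis (evenCycleDegLex m) (Set.range (cycleBasis R m))
      (Ideal.span (Set.range (cycleBasis R m))) := by
  refine isGroebnerBasis_range (fun p => (degree_cycleBasis hm p).1) fun p q u hp hq => ?_
  rw [(degree_cycleBasis hm _).2] at hp hq
  rcases lt_trichotomy (p : ℕ) q with h | h | h
  · exact congrBelow_of_lt hm h q.2 hp hq
  · rw [Fin.ext h]
    exact CongrBelow.refl _ _
  · exact (congrBelow_of_lt hm h p.2 hq hp).symm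

end Buchberger

/-! ### The basis generates the critical ideal. -/

section CriticalIdeal

open MvPolynomial

theorem omitIdx_eq_succAbove {k : ℕ} (i : Fin (k + 1)) :
    omitIdx i = (i.succAbove : Fin k → Fin (k + 1)) := by
  funext a
  ext
  simp only [omitIdx, Fin.succAbove, Fin.lt_def, Fin.val_castSucc]
  split_ifs <;> rfl

theorem adjugate_eq_det_deleteRowCol {A : Type*} [CommRing A] {n : ℕ}
    (M : Matrix (Fin n) (Fin n) A) (i j : Fin n) :
    M.adjugate i j = (-1) ^ (j + i : ℕ) * (deleteRowCol M j i).det := by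
  rcases n with _ | k
  · exact i.elim0
  · rw [Matrix.adjugate_fin_succ_eq_det_submatrix, deleteRowCol, omitIdx_eq_succAbove,
      omitIdx_eq_succAbove]

theorem exists_omitIdx_eq {n : ℕ} [NeZero n] (f : Fin (n - 1) ↪o Fin n) :
    ∃ i, (f : Fin (n - 1) → Fin n) = omitIdx i := by
  obtain ⟨k, rfl⟩ : ∃ k, n = k + 1 := ⟨n - 1, by have := NeZero.ne n; omega⟩
  change Fin k ↪o Fin (k + 1) at f
  have hns : ¬ Function.Surjective f := by
    intro h
    have := Fintype.card_le_of_surjective f h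
    simp at this
  obtain ⟨i, hi⟩ := not_forall.mp hns
  refine ⟨i, ?_⟩
  have hrange : Set.range f = Set.range i.succAbove := by
    rw [Fin.range_succAbove]
    refine Set.eq_of_subset_of_ncard_le ?_ ?_ (Set.toFinite _)
    · rintro _ ⟨a, rfl⟩ h
      exact hi ⟨a, h⟩
    · have e1 : (Set.range f).ncard = k := by
        rw [← Set.image_univ, Set.ncard_image_of_injective _ f.injective, Set.ncard_univ,
          Nat.card_eq_fintype_card, Fintype.card_fin]
      have e2 : ({i}ᶜ : Set (Fin (k + 1))).ncard = k := by
        rw [← Fin.range_succAbove, ← Set.image_univ,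
          Set.ncard_image_of_injective _ Fin.succAbove_right_injective, Set.ncard_univ,
          Nat.card_eq_fintype_card, Fintype.card_fin]
      rw [e1, e2]
  rw [omitIdx_eq_succAbove]
  exact (StrictMono.range_inj f.strictMono (Fin.strictMono_succAbove i)).mp hrange

theorem exists_orderEmbedding_eq_omitIdx {n : ℕ} (i : Fin n) :
    ∃ f : Fin (n - 1) ↪o Fin n, (f : Fin (n - 1) → Fin n) = omitIdx i := by
  rcases n with _ | k
  · exact i.elim0
  · exact ⟨i.succAboveOrderEmb, (omitIdx_eq_succAbove i).symm⟩

/-- The ideal of submaximal minors is generated by the entries of the adjugate. -/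
theorem minorsIdeal_eq_span_adjugate {A : Type*} [CommRing A] {n : ℕ} [NeZero n]
    (M : Matrix (Fin n) (Fin n) A) :
    minorsIdeal (n - 1) M = Ideal.span {f | ∃ i j, f = M.adjugate i j} := by
  refine le_antisymm (Ideal.span_le.mpr ?_) (Ideal.span_le.mpr ?_)
  · rintro _ ⟨rows, cols, rfl⟩
    obtain ⟨i, hi⟩ := exists_omitIdx_eq rows
    obtain ⟨j, hj⟩ := exists_omitIdx_eq cols
    have e : (M.submatrix rows cols).det = (-1) ^ (i + j : ℕ) * M.adjugate j i := by
      rw [adjugate_eq_det_deleteRowCol, ← mul_assoc, ← mul_pow, neg_one_mul, neg_neg, one_pow,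
        one_mul, deleteRowCol, hi, hj]
    rw [e]
    exact Ideal.mul_mem_left _ _ (Ideal.subset_span ⟨j, i, rfl⟩)
  · rintro _ ⟨i, j, rfl⟩
    obtain ⟨rows, hr⟩ := exists_orderEmbedding_eq_omitIdx j
    obtain ⟨cols, hc⟩ := exists_orderEmbedding_eq_omitIdx i
    rw [adjugate_eq_det_deleteRowCol]
    refine Ideal.mul_mem_left _ _ (Ideal.subset_span ⟨rows, cols, ?_⟩)
    rw [deleteRowCol, hr, hc]

variable (R : Type*) [CommRing R] {m : ℕ} [NeZero (2 * m)]

theorem cycleAdj_opposite_mem (p : ℕ) (hm : 3 ≤ m) :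
    cycleAdj R (2 * m) (p + m) p ∈ Ideal.span (Set.range (cycleBasis R m)) := by
  induction p using Nat.strong_induction_on with
  | _ p ih =>
  rcases lt_or_ge p m with h | h
  · rw [← cycleBasis_of_lt R h]
    exact Ideal.subset_span ⟨_, rfl⟩
  · have := ih (p - m) (by omega)
    rw [← cycleAdj_opposite_add, show p - m + m = p by omega] at this
    exact this

/-- Modulo the span, the relation for O_p gives N_{p+m-1} ≡ -N_p. Applying it twice around the cycle
gives N_{p+2} ≡ N_p, so one basis element of each parity suffices. -/
theorem cycleAdj_nearOpposite_mem (hm : 3 ≤ m) (p : ℕ) :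
    cycleAdj R (2 * m) (p + (m + 1)) p ∈ Ideal.span (Set.range (cycleBasis R m)) := by
  have rel : ∀ p, cycleAdj R (2 * m) (p + m - 1 + (m + 1)) (p + m - 1) +
      cycleAdj R (2 * m) (p + (m + 1)) p ∈ Ideal.span (Set.range (cycleBasis R m)) := by
    intro p
    rw [← X_mul_cycleAdj_opposite R hm]
    exact Ideal.mul_mem_left _ _ (cycleAdj_opposite_mem R p hm)
  have period : ∀ p, cycleAdj R (2 * m) (p + 2 * m + (m + 1)) (p + 2 * m) =
      cycleAdj R (2 * m) (p + (m + 1)) p := by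
    intro p
    refine cycleAdj_congr R _ ?_ ?_
    · rw [show p + 2 * m + (m + 1) = p + (m + 1) + 2 * m by omega, Nat.ModEq, Nat.add_mod_right]
    · rw [Nat.ModEq, Nat.add_mod_right]
  have step : ∀ p, cycleAdj R (2 * m) (p + (m + 1)) p ∈
      Ideal.span (Set.range (cycleBasis R m)) →
      cycleAdj R (2 * m) (p + 2 + (m + 1)) (p + 2) ∈
        Ideal.span (Set.range (cycleBasis R m)) := by
    intro p hp
    have h1 := rel (p + m + 1)
    have h2 := rel (p + 2)
    rw [show p + m + 1 + m - 1 = p + 2 * m by omega, period] at h1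
    rw [show p + 2 + m - 1 = p + m + 1 by omega] at h2
    exact (Ideal.add_mem_iff_right _ ((Ideal.add_mem_iff_right _ hp).mp h1)).mp h2
  have up : ∀ k, cycleAdj R (2 * m) (m + k + (m + 1)) (m + k) ∈
      Ideal.span (Set.range (cycleBasis R m)) := by
    -- The seeds are N_m and N_{m+1}; the second belongs to the basis because m + 1 ≤ 2m - 2, that
    -- is, m ≥ 3.
    intro k
    induction k using Nat.twoStepInduction with
    | zero =>
      rw [add_zero, ← cycleBasis_of_le R le_rfl (by omega)]
      exact Ideal.subset_span ⟨_, rfl⟩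
    | one =>
      rw [← cycleBasis_of_le R (by omega) (by omega)]
      exact Ideal.subset_span ⟨_, rfl⟩
    | more k ih _ => exact step _ ih
  have := up (p + m)
  rw [show m + (p + m) = p + 2 * m by omega, period] at this
  exact this

/-- Starting from distances m and m + 1, the three-term relation expresses each shorter distance
through the two preceding ones, down to the diagonal. Symmetry covers distances beyond m. -/
theorem cycleAdj_mem (hm : 3 ≤ m) (i j : ℕ) (hi : i < 2 * m) (hj : j < 2 * m) :
    cycleAdj R (2 * m) i j ∈ Ideal.span (Set.range (cycleBasis R m)) := by
  have near : ∀ p e, e ≤ m →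
      cycleAdj R (2 * m) (p + (m - e)) p ∈ Ideal.span (Set.range (cycleBasis R m)) ∧
      cycleAdj R (2 * m) (p + (m + 1 - e)) p ∈ Ideal.span (Set.range (cycleBasis R m)) := by
    intro p e
    induction e with
    | zero =>
      intro _
      exact ⟨cycleAdj_opposite_mem R p hm, cycleAdj_nearOpposite_mem R hm p⟩
    | succ e ih =>
      intro he
      obtain ⟨h1, h2⟩ := ih (by omega)
      rw [show m + 1 - (e + 1) = m - e by omega]
      refine ⟨?_, h1⟩
      have h := X_mul_cycleAdj R (n := 2 * m) (i := p + (m - (e + 1))) (j := p) (by omega)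
        (fun h => not_modEq_of_lt (by omega) (by omega) h.symm)
      rw [show p + (m - (e + 1)) + 1 = p + (m - e) by omega,
        show p + (m - (e + 1)) + 2 = p + (m + 1 - e) by omega] at h
      refine (Ideal.add_mem_iff_left _ h2).mp ?_
      rw [← h]
      exact Ideal.mul_mem_left _ _ h1
  have close : ∀ i j, j ≤ i → i ≤ j + m →
      cycleAdj R (2 * m) i j ∈ Ideal.span (Set.range (cycleBasis R m)) := by
    intro i j h h'
    have := (near j (m - (i - j)) (by omega)).1
    rwa [show j + (m - (m - (i - j))) = i by omega] at this
  have ordered : ∀ i j, i < 2 * m → j ≤ i →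
      cycleAdj R (2 * m) i j ∈ Ideal.span (Set.range (cycleBasis R m)) := by
    intro i j hi h
    rcases le_or_gt i (j + m) with h' | h'
    · exact close i j h h'
    · rw [cycleAdj_comm, cycleAdj_congr R (2 * m) (i' := j + 2 * m) (j' := i)
        (by rw [Nat.ModEq, Nat.add_mod_right]) rfl]
      exact close _ _ (by omega) (by omega)
  rcases le_total j i with h | h
  · exact ordered i j hi h
  · rw [cycleAdj_comm]
    exact ordered j i hj h

theorem criticalIdeal_cycleGraph_eq_span (hm : 3 ≤ m) :
    criticalIdeal R (2 * m - 1) (SimpleGraph.cycleGraph (2 * m)) =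
      Ideal.span (Set.range (cycleBasis R m)) := by
  rw [criticalIdeal, minorsIdeal_eq_span_adjugate]
  refine le_antisymm (Ideal.span_le.mpr ?_) (Ideal.span_mono ?_)
  · rintro _ ⟨i, j, rfl⟩
    have := cycleAdj_mem R hm i j i.2 j.2
    rwa [cycleAdj, Fin.ofNat_val_eq_self, Fin.ofNat_val_eq_self] at this
  · rintro _ ⟨p, rfl⟩
    exact ⟨_, _, rfl⟩

variable {R} in
-- The minor is ± the adjugate entry, so when that entry is monic the normalisation of q_{i,j}
-- undoes exactly the cofactor sign.
theorem cycleQ_eq_of_monic {n : ℕ} {ord : MonomialOrder (Fin n)} {i j : Fin n}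
    (h : ord.Monic ((genLaplacian R (SimpleGraph.cycleGraph n)).adjugate j i)) :
    cycleQ R ord i j = (genLaplacian R (SimpleGraph.cycleGraph n)).adjugate j i := by
  have e := adjugate_eq_det_deleteRowCol (genLaplacian R (SimpleGraph.cycleGraph n)) j i
  rw [cycleQ]
  generalize (genLaplacian R (SimpleGraph.cycleGraph n)).adjugate j i = b at *
  generalize (deleteRowCol (genLaplacian R (SimpleGraph.cycleGraph n)) i j).det = d at *
  rcases neg_one_pow_eq_or (MvPolynomial (Fin n) R) (i + j : ℕ) with hs | hs
  · rw [hs, one_mul] at e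
    subst e
    split_ifs with hl
    -- A monic minor is negated only when 1 = -1 in `R`, and then the negation changes nothing.
    · rw [h.leadingCoeff_eq_one] at hl
      rw [← neg_one_mul, ← C_1, ← C_neg, ← hl, C_1, one_mul]
    · rfl
  · rw [hs, neg_one_mul] at e
    have hd : d = -b := by rw [e, neg_neg]
    subst hd
    rw [if_pos (by rw [MonomialOrder.leadingCoeff_neg, h.leadingCoeff_eq_one]), neg_neg]

theorem Fin.ofNat_eq_mk {n : ℕ} [NeZero n] {a b : ℕ} (hb : b < n) (h : a = b ∨ a = b + n) :
    Fin.ofNat n a = ⟨b, hb⟩ := by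
  ext
  rw [Fin.val_ofNat]
  rcases h with rfl | rfl
  · exact Nat.mod_eq_of_lt hb
  · rw [Nat.add_mod_right]
    exact Nat.mod_eq_of_lt hb

theorem evenCycleBasis_eq_range [Nontrivial R] (hm : 3 ≤ m) :
    evenCycleBasis R m = Set.range (cycleBasis R m) := by
  have first : ∀ i (hi : i < m), cycleQ R (evenCycleDegLex m) ⟨i, by omega⟩ ⟨i + m, by omega⟩ =
      cycleBasis R m ⟨i, by omega⟩ := by
    intro i hi
    have e : cycleBasis R m ⟨i, by omega⟩ =
        (genLaplacian R (SimpleGraph.cycleGraph (2 * m))).adjugate ⟨i + m, by omega⟩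
          ⟨i, by omega⟩ := by
      rw [cycleBasis_of_lt R hi, cycleAdj, Fin.ofNat_eq_mk _ (Or.inl rfl),
        Fin.ofNat_eq_mk _ (Or.inl rfl)]
    rw [e]
    exact cycleQ_eq_of_monic (e ▸ (degree_cycleBasis hm _).1)
  have second : ∀ i (hi : i + 1 < m),
      cycleQ R (evenCycleDegLex m) ⟨i + m, by omega⟩ ⟨i + 1, by omega⟩ =
        cycleBasis R m ⟨i + m, by omega⟩ := by
    intro i hi
    have e : cycleBasis R m ⟨i + m, by omega⟩ =
        (genLaplacian R (SimpleGraph.cycleGraph (2 * m))).adjugate ⟨i + 1, by omega⟩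
          ⟨i + m, by omega⟩ := by
      rw [cycleBasis_of_le R (by omega) (by omega), cycleAdj,
        -- N_{i+m} = a(i+2m+1, i+m), whose first index is i + 1 modulo 2m.
        Fin.ofNat_eq_mk (b := i + 1) (by omega) (Or.inr (by omega)),
        Fin.ofNat_eq_mk (b := i + m) (by omega) (Or.inl rfl)]
    rw [e]
    exact cycleQ_eq_of_monic (e ▸ (degree_cycleBasis hm _).1)
  ext f
  constructor
  · rintro (⟨i, hi, rfl⟩ | ⟨i, hi, rfl⟩)
    · exact ⟨_, (first i hi).symm⟩
    · exact ⟨_, (second i hi).symm⟩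
  · rintro ⟨⟨p, hp⟩, rfl⟩
    rcases lt_or_ge p m with h | h
    · exact Or.inl ⟨p, h, (first p h).symm⟩
    · obtain ⟨i, rfl⟩ : ∃ i, p = i + m := ⟨p - m, by omega⟩
      exact Or.inr ⟨i, by omega, (second i (by omega)).symm⟩

end CriticalIdeal

theorem mainTheorem2 (R : Type*) [CommRing R] [Nontrivial R] (m : ℕ) (hm : 6 ≤ 2 * m) :
    IsGroebnerBasis (evenCycleDegLex m) (evenCycleBasis R m)
      (criticalIdeal R (2 * m - 1) (SimpleGraph.cycleGraph (2 * m))) := by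
  have hm' : 3 ≤ m := by omega
  have : NeZero (2 * m) := ⟨by omega⟩
  rw [evenCycleBasis_eq_range R hm', criticalIdeal_cycleGraph_eq_span R hm']
  exact isGroebnerBasis_cycleBasis hm'
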